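/- Let $A=(a_{ij})_{i,j=1}^n$ be a symmetrizable generalized Cartan matrix: $a_{ii}=2$, $a_{ij}\in\mathbb{Z}_{\le 0}$ for $i\neq j$, $a_{ij}=0$ implies $a_{ji}=0$, and $A=DS$ with $D$ an invertible diagonal and $S$ a symmetric matrix. Let $(\mathfrak{h},\{\alpha_i\},\{h_i\})$ be a realization of $A$: $\mathfrak{h}$ is a complex vector space of dimension $2n-\mathrm{rk}(A)$, and $\{\alpha_i\}_{i=1}^n\subset\mathfrak{h}^*$, $\{h_i\}_{i=1}^n\subset\mathfrak{h}$ are linearly independent with $\alpha_j(h_i)=a_{ij}$. Let $\mathfrak{g}(A)$ be the Kac–Moody algebra, i.e. the complex Lie algebra generated by the vector space $\mathfrak{h}$ and elements $e_i,f_i$ ($1\le i\le n$) with defining relations $$[h,h']=0,\quad [h,e_j]=\alpha_j(h)e_j,\quad [h,f_j]=-\alpha_j(h)f_j,\quad [e_i,f_j]=\delta_{ij}h_i,\quad (\mathrm{ad}\,e_i)^{1-a_{ij}}e_j=0=(\mathrm{ad}\,f_i)^{1-a_{ij}}f_j\ (i\ne j).$$ Let $\omega$ be its Chevalley involution ($\omega(h)=-h$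 for $h\in\mathfrak{h}$, $\omega(e_i)=-f_i$, $\omega(f_i)=-e_i$), let $\mathfrak{k}(A)=\{x\in\mathfrak{g}(A):\omega(x)=x\}$, and let $\mathfrak{n}(A)$ be the Lie subalgebra generated by $e_1,\dots,e_n$, with graded components $\mathfrak{n}_k(A)$ ($k\ge 1$) the sum of the root spaces $\mathfrak{g}_\alpha(A)=\{x:[h,x]=\alpha(h)x\ \forall h\in\mathfrak{h}\}$ over the positive roots $\alpha=\sum_i r_i\alpha_i$ ($r_i\in\mathbb{Z}_{\ge0}$) of height $\sum_i r_i=k$. For $i\ne j$ define integers $c^{ij}_s[r]$ ($0\le s\le r$) by $c^{ij}_r[r]=1$, $c^{ij}_{r-1}[r]=0$ for $r\ge1$, and, for $r\ge 2$ and $0\le s\le r-2$, $c^{ij}_s[r]=c^{ij}_{s-1}[r-1]-(r-1)(r-2+a_{ij})\,c^{ij}_s[r-2]$, where $c^{ij}_{-1}[r]:=0$. Let $\mathcal{L}(A)$ (the generalized Onsager algebra) be the complex Lie algebra with generators $B_1,\dots,B_n$ and defining relations $$\sum_{s=0}^{1-a_{ij}}c^{ij}_s[1-a_{ij}]\,(\mathrm{ad}\,B_i)^sB_j=0\qquad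 (i\ne j).$$ Filter $\mathcal{L}(A)$ by $\mathcal{L}_0(A)=\{0\}$ and $\mathcal{L}_j(A)=\mathrm{span}\{[B_{i_1},[B_{i_2},\dots,[B_{i_{m-1}},B_{i_m}]\dots]] : 1\le m\le j,\ 1\le i_1,\dots,i_m\le n\}$. Let $\mathrm{Gr}(\mathcal{L}(A))=\bigoplus_{j\ge1}\mathrm{Gr}_j(\mathcal{L}(A))$, with $\mathrm{Gr}_j(\mathcal{L}(A))=\mathcal{L}_j(A)/\mathcal{L}_{j-1}(A)$, be the associated graded Lie algebra, and write $[x]_j$ for the class of $x\in\mathcal{L}_j(A)$ in $\mathrm{Gr}_j(\mathcal{L}(A))$. **a.** There is a unique Lie algebra homomorphism $\psi:\mathcal{L}(A)\to\mathfrak{k}(A)$ with $\psi(B_i)=Y_i:=e_i-f_i$ for $i=1,\dots,n$, and it is an isomorphism. **b.** There is a unique Lie algebra homomorphism $\varphi:\mathfrak{n}(A)\to\mathrm{Gr}(\mathcal{L}(A))$ with $\varphi(e_i)=[B_i]_1$ for $i=1,\dots,n$, and it is an isomorphism of graded Lie algebras: it is bijective and $\varphi(\mathfrak{n}_k(A))=\mathrm{Gr}_k(\mathcal{L}(A))$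 for all $k\ge1$. -/

import Mathlib

open scoped DirectSum

noncomputable section

universe u v

/-! ### Generalized Cartan matrices and their realizations -/

/-- Generalized Cartan matrices. -/
structure IsGeneralizedCartanMatrix {n : ℕ} (A : Matrix (Fin n) (Fin n) ℤ) : Prop where
  diag : ∀ i, A i i = 2
  off_diag_nonpos : ∀ i j, i ≠ j → A i j ≤ 0
  zero_symm : ∀ i j, A i j = 0 → A j i = 0

/-- `A` is symmetrizable if `A = D * S` with `D` an invertible diagonal and `S` a symmetric
complex matrix. -/
def IsSymmetrizableMatrix {n : ℕ} (A : Matrix (Fin n) (Fin n) ℤ) : Prop :=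
  ∃ (d : Fin n → ℂ) (S : Matrix (Fin n) (Fin n) ℂ),
    (∀ i, d i ≠ 0) ∧ S.IsSymm ∧ A.map (Int.cast : ℤ → ℂ) = Matrix.diagonal d * S

/-- A realization `(𝔥, {αᵢ}, {hᵢ})` of `A` on a complex vector space `𝔥` of dimension
`2 n - rk A`. -/
structure CartanRealization {n : ℕ} (A : Matrix (Fin n) (Fin n) ℤ) (𝔥 : Type u)
    [AddCommGroup 𝔥] [Module ℂ 𝔥] where
  /-- the simple roots -/
  root : Fin n → Module.Dual ℂ 𝔥
  /-- the simple coroots -/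
  coroot : Fin n → 𝔥
  finiteDimensional : FiniteDimensional ℂ 𝔥
  finrank_add_rank : Module.finrank ℂ 𝔥 + (A.map (Int.cast : ℤ → ℂ)).rank = 2 * n
  linearIndependent_root : LinearIndependent ℂ root
  linearIndependent_coroot : LinearIndependent ℂ coroot
  root_coroot : ∀ i j, root j (coroot i) = (A i j : ℂ)

/-! ### Complex Lie algebras given by generators and relations -/

/-- The complex Lie algebra with generators `X` and defining relations `r = 0` for `r ∈ rels`. -/
def PresentedLieAlgebra {X : Type u} (rels : Set (FreeLieAlgebra ℂ X)) : Type u :=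
  FreeLieAlgebra ℂ X ⧸ LieSubmodule.lieSpan ℂ (FreeLieAlgebra ℂ X) rels

namespace PresentedLieAlgebra

variable {X : Type u} (rels : Set (FreeLieAlgebra ℂ X))

instance : LieRing (PresentedLieAlgebra rels) :=
  inferInstanceAs (LieRing
    (FreeLieAlgebra ℂ X ⧸ LieSubmodule.lieSpan ℂ (FreeLieAlgebra ℂ X) rels))

instance : LieAlgebra ℂ (PresentedLieAlgebra rels) :=
  inferInstanceAs (LieAlgebra ℂ
    (FreeLieAlgebra ℂ X ⧸ LieSubmodule.lieSpan ℂ (FreeLieAlgebra ℂ X) rels))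

/-- The quotient map from the free Lie algebra. -/
def mk : FreeLieAlgebra ℂ X →ₗ⁅ℂ⁆ PresentedLieAlgebra rels where
  toFun x := LieSubmodule.Quotient.mk x
  map_add' _ _ := rfl
  map_smul' _ _ := rfl
  map_lie' := rfl

/-- The generator attached to `x : X`. -/
def of (x : X) : PresentedLieAlgebra rels := mk rels (FreeLieAlgebra.of ℂ x)

variable {rels}

theorem mk_surjective : Function.Surjective (mk rels) := fun y => by
  obtain ⟨x, rfl⟩ := LieSubmodule.Quotient.surjective_mk' _ y
  exact ⟨x, rfl⟩

theorem mk_of (x : X) : mk rels (FreeLieAlgebra.of ℂ x) = of rels x := rfl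

theorem mk_eq_zero {r : FreeLieAlgebra ℂ X} (hr : r ∈ rels) : mk rels r = 0 :=
  (LieSubmodule.Quotient.mk_eq_zero
    (N := LieSubmodule.lieSpan ℂ (FreeLieAlgebra ℂ X) rels)).2 (LieSubmodule.subset_lieSpan hr)

variable {L : Type v} [LieRing L] [LieAlgebra ℂ L]

/-- The homomorphism that a map on generators respecting the relations induces. -/
def lift (f : X → L) (hf : ∀ r ∈ rels, FreeLieAlgebra.lift ℂ f r = 0) :
    PresentedLieAlgebra rels →ₗ⁅ℂ⁆ L :=
  let I := LieSubmodule.lieSpan ℂ (FreeLieAlgebra ℂ X) rels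
  have hI : I ≤ (FreeLieAlgebra.lift ℂ f).ker :=
    LieSubmodule.lieSpan_le.2 fun r hr => LieHom.mem_ker.2 (hf r hr)
  { Submodule.liftQ I.toSubmodule (FreeLieAlgebra.lift ℂ f : FreeLieAlgebra ℂ X →ₗ[ℂ] L)
      (fun _ hx => LieHom.mem_ker.1 (hI hx)) with
    map_lie' := by
      intro x y
      obtain ⟨x, rfl⟩ := mk_surjective x
      obtain ⟨y, rfl⟩ := mk_surjective y
      exact (FreeLieAlgebra.lift ℂ f).map_lie x y }

theorem lift_mk (f : X → L) (hf : ∀ r ∈ rels, FreeLieAlgebra.lift ℂ f r = 0)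
    (x : FreeLieAlgebra ℂ X) : lift f hf (mk rels x) = FreeLieAlgebra.lift ℂ f x := rfl

theorem lift_of (f : X → L) (hf : ∀ r ∈ rels, FreeLieAlgebra.lift ℂ f r = 0) (x : X) :
    lift f hf (of rels x) = f x :=
  FreeLieAlgebra.lift_of_apply f x

theorem hom_ext {F G : PresentedLieAlgebra rels →ₗ⁅ℂ⁆ L}
    (h : ∀ x, F (of rels x) = G (of rels x)) : F = G := by
  have hFG : F.comp (mk rels) = G.comp (mk rels) := FreeLieAlgebra.hom_ext h
  ext y
  obtain ⟨x, rfl⟩ := mk_surjective y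
  exact LieHom.congr_fun hFG x

theorem lieSpan_range_of : LieSubalgebra.lieSpan ℂ _ (Set.range (of rels)) = ⊤ := by
  set K := LieSubalgebra.lieSpan ℂ _ (Set.range (of rels))
  let g : X → K := fun x => ⟨of rels x, LieSubalgebra.subset_lieSpan ⟨x, rfl⟩⟩
  have hK : K.incl.comp (FreeLieAlgebra.lift ℂ g) = mk rels :=
    FreeLieAlgebra.hom_ext fun x => by
      rw [LieHom.comp_apply, FreeLieAlgebra.lift_of_apply]; rfl
  refine eq_top_iff.2 fun y _ => ?_
  obtain ⟨x, rfl⟩ := mk_surjective y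
  rw [← hK]
  exact (FreeLieAlgebra.lift ℂ g x).2

end PresentedLieAlgebra

/-! ### The Kac-Moody algebra -/

/-- The generators `h ∈ 𝔥`, `eᵢ` and `fᵢ` of the Kac-Moody algebra. -/
inductive KacMoodyGenerator (n : ℕ) (𝔥 : Type u) : Type u
  | h (x : 𝔥) : KacMoodyGenerator n 𝔥
  | e (i : Fin n) : KacMoodyGenerator n 𝔥
  | f (i : Fin n) : KacMoodyGenerator n 𝔥

section KacMoody

variable {n : ℕ} {A : Matrix (Fin n) (Fin n) ℤ} {𝔥 : Type u} [AddCommGroup 𝔥] [Module ℂ 𝔥]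

namespace KacMoodyGenerator

/-- The generator `x ∈ 𝔥` in the free Lie algebra. -/
def H (n : ℕ) (x : 𝔥) : FreeLieAlgebra ℂ (KacMoodyGenerator n 𝔥) :=
  FreeLieAlgebra.of ℂ (h x)

/-- The generator `eᵢ` in the free Lie algebra. -/
def E (𝔥 : Type u) {n : ℕ} (i : Fin n) : FreeLieAlgebra ℂ (KacMoodyGenerator n 𝔥) :=
  FreeLieAlgebra.of ℂ (e i)

/-- The generator `fᵢ` in the free Lie algebra. -/
def F (𝔥 : Type u) {n : ℕ} (i : Fin n) : FreeLieAlgebra ℂ (KacMoodyGenerator n 𝔥) :=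
  FreeLieAlgebra.of ℂ (f i)

end KacMoodyGenerator

open KacMoodyGenerator in
/-- The defining relations of the Kac-Moody algebra; the first two say that `𝔥` embeds
linearly. -/
inductive KacMoodyRelation (R : CartanRealization A 𝔥) :
    FreeLieAlgebra ℂ (KacMoodyGenerator n 𝔥) → Prop
  | add (x y : 𝔥) : KacMoodyRelation R (H n (x + y) - (H n x + H n y))
  | smul (c : ℂ) (x : 𝔥) : KacMoodyRelation R (H n (c • x) - c • H n x)
  | h_h (x y : 𝔥) : KacMoodyRelation R ⁅H n x, H n y⁆
  | h_e (x : 𝔥) (j : Fin n) : KacMoodyRelation R (⁅H n x, E 𝔥 j⁆ - R.root j x • E 𝔥 j)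
  | h_f (x : 𝔥) (j : Fin n) : KacMoodyRelation R (⁅H n x, F 𝔥 j⁆ + R.root j x • F 𝔥 j)
  | e_f_same (i : Fin n) : KacMoodyRelation R (⁅E 𝔥 i, F 𝔥 i⁆ - H n (R.coroot i))
  | e_f_ne (i j : Fin n) (hij : i ≠ j) : KacMoodyRelation R ⁅E 𝔥 i, F 𝔥 j⁆
  | serre_e (i j : Fin n) (hij : i ≠ j) :
      KacMoodyRelation R (((LieAlgebra.ad ℂ _ (E 𝔥 i)) ^ (1 - A i j).toNat) (E 𝔥 j))
  | serre_f (i j : Fin n) (hij : i ≠ j) :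
      KacMoodyRelation R (((LieAlgebra.ad ℂ _ (F 𝔥 i)) ^ (1 - A i j).toNat) (F 𝔥 j))

/-- The Kac-Moody algebra `𝔤(A)`. -/
abbrev KacMoodyAlgebra (R : CartanRealization A 𝔥) : Type u :=
  PresentedLieAlgebra {r | KacMoodyRelation R r}

namespace KacMoodyAlgebra

variable (R : CartanRealization A 𝔥)

/-- The image of `x ∈ 𝔥` in `𝔤(A)`. -/
def h (x : 𝔥) : KacMoodyAlgebra R := PresentedLieAlgebra.of _ (.h x)

/-- The Chevalley generators `eᵢ`. -/
def e (i : Fin n) : KacMoodyAlgebra R := PresentedLieAlgebra.of _ (.e i)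

/-- The Chevalley generators `fᵢ`. -/
def f (i : Fin n) : KacMoodyAlgebra R := PresentedLieAlgebra.of _ (.f i)

/-- A linear map that intertwines brackets intertwines iterated brackets. -/
theorem map_ad_pow {L : Type*} {M : Type*} [LieRing L] [LieAlgebra ℂ L] [LieRing M]
    [LieAlgebra ℂ M] (φ : L →ₗ⁅ℂ⁆ M) (x y : L) (k : ℕ) :
    φ (((LieAlgebra.ad ℂ L x) ^ k) y) = ((LieAlgebra.ad ℂ M (φ x)) ^ k) (φ y) := by
  induction k with
  | zero => simp
  | succ k ih => rw [pow_succ', pow_succ', Module.End.mul_apply, Module.End.mul_apply,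
      LieAlgebra.ad_apply, LieAlgebra.ad_apply, LieHom.map_lie, ih]

theorem ad_neg_pow {L : Type*} [LieRing L] [LieAlgebra ℂ L] (x y : L) (k : ℕ)
    (hxy : ((LieAlgebra.ad ℂ L x) ^ k) y = 0) : ((LieAlgebra.ad ℂ L (-x)) ^ k) (-y) = 0 := by
  rw [map_neg, map_neg, neg_pow]
  rcases neg_one_pow_eq_or (Module.End ℂ L) k with hk | hk <;> simp [hk, hxy]

/-- The values of the Chevalley involution on the generators. -/
def chevalleyOnGenerators : KacMoodyGenerator n 𝔥 → KacMoodyAlgebra R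
  | .h x => -h R x
  | .e i => -f R i
  | .f i => -e R i

theorem chevalley_relation (r : FreeLieAlgebra ℂ (KacMoodyGenerator n 𝔥))
    (hr : KacMoodyRelation R r) :
    FreeLieAlgebra.lift ℂ (chevalleyOnGenerators R) r = 0 := by
  set ρ := FreeLieAlgebra.lift ℂ (chevalleyOnGenerators R)
  have hH (x : 𝔥) : ρ (KacMoodyGenerator.H n x) = -h R x := FreeLieAlgebra.lift_of_apply ..
  have hE (i : Fin n) : ρ (KacMoodyGenerator.E 𝔥 i) = -f R i := FreeLieAlgebra.lift_of_apply ..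
  have hF (i : Fin n) : ρ (KacMoodyGenerator.F 𝔥 i) = -e R i := FreeLieAlgebra.lift_of_apply ..
  have key {r} (hr : KacMoodyRelation R r) : PresentedLieAlgebra.mk {r | KacMoodyRelation R r} r = 0 :=
    PresentedLieAlgebra.mk_eq_zero hr
  have mH (x : 𝔥) : PresentedLieAlgebra.mk {r | KacMoodyRelation R r}
    (KacMoodyGenerator.H n x) = h R x := rfl
  have mE (i : Fin n) : PresentedLieAlgebra.mk {r | KacMoodyRelation R r}
    (KacMoodyGenerator.E 𝔥 i) = e R i := rfl
  have mF (i : Fin n) : PresentedLieAlgebra.mk {r | KacMoodyRelation R r}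
    (KacMoodyGenerator.F 𝔥 i) = f R i := rfl
  cases hr with
  | add x y =>
    have := key (.add x y)
    simp only [map_sub, map_add, mH, hH] at this ⊢
    rw [sub_eq_zero] at this ⊢
    rw [this]; abel
  | smul c x =>
    have := key (.smul c x)
    simp only [map_sub, map_smul, mH, hH] at this ⊢
    rw [sub_eq_zero] at this ⊢
    rw [this, smul_neg]
  | h_h x y =>
    have := key (.h_h x y)
    simp only [LieHom.map_lie, mH, hH] at this ⊢
    simpa using this
  | h_e x j =>
    have := key (.h_f x j)
    simp only [LieHom.map_lie, map_sub, map_add, map_smul, mH, hH, mF, hE] at this ⊢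
    simpa using this
  | h_f x j =>
    have := key (.h_e x j)
    simp only [LieHom.map_lie, map_sub, map_add, map_smul, mH, hH, mE, hF] at this ⊢
    simpa [sub_eq_add_neg] using this
  | e_f_same i =>
    have := key (.e_f_same i)
    simp only [LieHom.map_lie, map_sub, mH, hH, mE, mF, hE, hF] at this ⊢
    rw [sub_eq_zero] at this
    rw [neg_lie, lie_neg, neg_neg, ← lie_skew, this]; abel
  | e_f_ne i j hij =>
    have := key (.e_f_ne j i hij.symm)
    simp only [LieHom.map_lie, mE, mF, hE, hF] at this ⊢
    rw [neg_lie, lie_neg, neg_neg, ← lie_skew, this, neg_zero]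
  | serre_e i j hij =>
    have := key (.serre_f i j hij)
    rw [map_ad_pow, mF, mF] at this
    rw [map_ad_pow, hE, hE]
    exact ad_neg_pow _ _ _ this
  | serre_f i j hij =>
    have := key (.serre_e i j hij)
    rw [map_ad_pow, mE, mE] at this
    rw [map_ad_pow, hF, hF]
    exact ad_neg_pow _ _ _ this

/-- The Chevalley involution `ω`, as a homomorphism. -/
def chevalleyHom : KacMoodyAlgebra R →ₗ⁅ℂ⁆ KacMoodyAlgebra R :=
  PresentedLieAlgebra.lift (chevalleyOnGenerators R) (chevalley_relation R)

theorem chevalleyHom_h (x : 𝔥) : chevalleyHom R (h R x) = -h R x :=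
  PresentedLieAlgebra.lift_of ..

theorem chevalleyHom_e (i : Fin n) : chevalleyHom R (e R i) = -f R i :=
  PresentedLieAlgebra.lift_of ..

theorem chevalleyHom_f (i : Fin n) : chevalleyHom R (f R i) = -e R i :=
  PresentedLieAlgebra.lift_of ..

theorem chevalleyHom_comp_self : (chevalleyHom R).comp (chevalleyHom R) = LieHom.id := by
  refine PresentedLieAlgebra.hom_ext fun x => ?_
  cases x with
  | h x =>
    change chevalleyHom R (chevalleyHom R (h R x)) = h R x
    rw [chevalleyHom_h, map_neg, chevalleyHom_h, neg_neg]
  | e i =>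
    change chevalleyHom R (chevalleyHom R (e R i)) = e R i
    rw [chevalleyHom_e, map_neg, chevalleyHom_f, neg_neg]
  | f i =>
    change chevalleyHom R (chevalleyHom R (f R i)) = f R i
    rw [chevalleyHom_f, map_neg, chevalleyHom_e, neg_neg]

/-- The Chevalley involution `ω` of `𝔤(A)`: the automorphism with `ω h = -h` for `h ∈ 𝔥`,
`ω eᵢ = -fᵢ` and `ω fᵢ = -eᵢ`. -/
def chevalleyInvolution : KacMoodyAlgebra R ≃ₗ⁅ℂ⁆ KacMoodyAlgebra R :=
  { chevalleyHom R with
    invFun := chevalleyHom R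
    left_inv := LieHom.congr_fun (chevalleyHom_comp_self R)
    right_inv := LieHom.congr_fun (chevalleyHom_comp_self R) }

/-- The fixed-point Lie subalgebra `𝔨(A)` of the Chevalley involution. -/
def fixedPoints : LieSubalgebra ℂ (KacMoodyAlgebra R) where
  carrier := {x | chevalleyInvolution R x = x}
  add_mem' {x y} hx hy := by
    rw [Set.mem_ofPred_eq] at hx hy ⊢
    rw [map_add, hx, hy]
  zero_mem' := map_zero _
  smul_mem' c x hx := by
    rw [Set.mem_ofPred_eq] at hx ⊢
    rw [map_smul, hx]
  lie_mem' {x y} hx hy := by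
    rw [Set.mem_ofPred_eq] at *
    rw [LieEquiv.map_lie, hx, hy]

/-- The Lie subalgebra `𝔫(A)` generated by the `eᵢ`. -/
def nilpotentPart : LieSubalgebra ℂ (KacMoodyAlgebra R) :=
  LieSubalgebra.lieSpan ℂ _ (Set.range (e R))

/-- The generators `eᵢ` as elements of `𝔫(A)`. -/
def nilpotentPart.e (i : Fin n) : nilpotentPart R :=
  ⟨KacMoodyAlgebra.e R i, LieSubalgebra.subset_lieSpan ⟨i, rfl⟩⟩

/-- The space `𝔤_α(A)` of all `x` with `[h, x] = α(h) x` for `h ∈ 𝔥`. -/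
def rootSpace (α : Module.Dual ℂ 𝔥) : Submodule ℂ (KacMoodyAlgebra R) where
  carrier := {x | ∀ y : 𝔥, ⁅h R y, x⁆ = α y • x}
  add_mem' {x x'} hx hx' y := by rw [lie_add, hx y, hx' y, smul_add]
  zero_mem' y := by simp
  smul_mem' c x hx y := by rw [lie_smul, hx y, smul_comm]

/-- The element `∑ rᵢ αᵢ` of the positive cone `Q₊` of the root lattice. -/
def posWeight (r : Fin n → ℕ) : Module.Dual ℂ 𝔥 := ∑ i, r i • R.root i

/-- `∑ rᵢ αᵢ` is a positive root. -/
def IsPositiveRoot (r : Fin n → ℕ) : Prop :=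
  posWeight R r ≠ 0 ∧ rootSpace R (posWeight R r) ≠ ⊥

/-- The graded component `𝔫_k(A)`: the sum, inside `𝔫(A)`, of the root spaces of the positive
roots of height `k`. -/
def nilpotentPart.component (k : ℕ) : Submodule ℂ (nilpotentPart R) :=
  (⨆ (r : Fin n → ℕ) (_ : IsPositiveRoot R r) (_ : ∑ i, r i = k),
    rootSpace R (posWeight R r)).comap (nilpotentPart R).toSubmodule.subtype

end KacMoodyAlgebra

end KacMoody

/-! ### The generalized Onsager algebra -/

/-- The integers `c_s[r]` belonging to the Cartan integer `a`, with `c_s[r] = 0` for `s > r`. -/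
def onsagerCoeff (a : ℤ) : ℕ → ℕ → ℤ
  | 0, 0 => 1
  | 0, _ + 1 => 0
  | 1, 0 => 0
  | 1, 1 => 1
  | 1, _ + 2 => 0
  | r + 2, 0 => -((r + 1) * (r + a)) * onsagerCoeff a r 0
  | r + 2, s + 1 => onsagerCoeff a (r + 1) s - (r + 1) * (r + a) * onsagerCoeff a r (s + 1)

section Onsager

variable {n : ℕ} (A : Matrix (Fin n) (Fin n) ℤ)

/-- The defining relations of the generalized Onsager algebra: the inhomogeneous Serre relations
`∑ₛ c_s[1 - aᵢⱼ] (ad Bᵢ)ˢ Bⱼ = 0`, `0 ≤ s ≤ 1 - aᵢⱼ`, for `i ≠ j`. -/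
inductive OnsagerRelation : FreeLieAlgebra ℂ (Fin n) → Prop
  | serre (i j : Fin n) (hij : i ≠ j) : OnsagerRelation
      (∑ s ∈ Finset.range ((1 - A i j).toNat + 1),
        (onsagerCoeff (A i j) (1 - A i j).toNat s : ℂ) •
          ((LieAlgebra.ad ℂ _ (FreeLieAlgebra.of ℂ i)) ^ s) (FreeLieAlgebra.of ℂ j))

/-- The generalized Onsager algebra `ℒ(A)`. -/
abbrev OnsagerAlgebra : Type :=
  PresentedLieAlgebra {r | OnsagerRelation A r}

/-- The generators `Bᵢ` of `ℒ(A)`. -/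
def OnsagerAlgebra.B (i : Fin n) : OnsagerAlgebra A := PresentedLieAlgebra.of _ i

end Onsager

/-! ### Filtered Lie algebras and their associated graded Lie algebras -/

/-- An exhaustive filtration `0 = F₀ ⊆ F₁ ⊆ F₂ ⊆ ⋯` of a complex Lie algebra. -/
structure LieFiltration (L : Type u) [LieRing L] [LieAlgebra ℂ L] where
  /-- the `j`-th filtered subspace -/
  space : ℕ → Submodule ℂ L
  mono : Monotone space
  space_zero : space 0 = ⊥
  exhaustive : ∀ x, ∃ j, x ∈ space j
  lie_mem : ∀ {i j : ℕ} {x y : L}, x ∈ space i → y ∈ space j → ⁅x, y⁆ ∈ space (i + j)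

namespace LieFiltration

variable {L : Type u} [LieRing L] [LieAlgebra ℂ L] (F : LieFiltration L)

/-- The quotient `F_j / F_{j-1}`, for `j ≥ 1`. -/
abbrev Piece (j : ℕ+) : Type u :=
  F.space j ⧸ (F.space ((j : ℕ) - 1)).submoduleOf (F.space j)

theorem lie_mem_left {i j : ℕ+} {x y : L} (hx : x ∈ F.space ((i : ℕ) - 1)) (hy : y ∈ F.space j) :
    ⁅x, y⁆ ∈ F.space (((i + j : ℕ+) : ℕ) - 1) := by
  have h := F.lie_mem hx hy
  have hi := i.pos
  rwa [show (i : ℕ) - 1 + j = ((i + j : ℕ+) : ℕ) - 1 by rw [PNat.add_coe]; omega] at h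

theorem lie_mem_right {i j : ℕ+} {x y : L} (hx : x ∈ F.space i) (hy : y ∈ F.space ((j : ℕ) - 1)) :
    ⁅x, y⁆ ∈ F.space (((i + j : ℕ+) : ℕ) - 1) := by
  rw [← lie_skew, neg_mem_iff, add_comm]
  exact F.lie_mem_left hy hx

theorem lie_mem_both {i j : ℕ+} {x y : L} (hx : x ∈ F.space i) (hy : y ∈ F.space j) :
    ⁅x, y⁆ ∈ F.space ((i + j : ℕ+) : ℕ) := by
  rw [PNat.add_coe]
  exact F.lie_mem hx hy

/-- The bracket `F_i × F_j → F_{i+j}`. -/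
def spaceBracket (i j : ℕ+) :
    F.space i →ₗ[ℂ] F.space j →ₗ[ℂ] F.space ((i + j : ℕ+) : ℕ) :=
  LinearMap.mk₂ ℂ (fun x y => ⟨⁅(x : L), (y : L)⁆, F.lie_mem_both x.2 y.2⟩)
    (fun _ _ _ => Subtype.ext (add_lie _ _ _)) (fun _ _ _ => Subtype.ext (smul_lie _ _ _))
    (fun _ _ _ => Subtype.ext (lie_add _ _ _)) (fun _ _ _ => Subtype.ext (lie_smul _ _ _))

/-- The bracket `F_i / F_{i-1} × F_j / F_{j-1} → F_{i+j} / F_{i+j-1}` that `[x]_i, [y]_j ↦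
[[x, y]]_{i+j}` defines. -/
def pieceBracket (i j : ℕ+) : F.Piece i →ₗ[ℂ] F.Piece j →ₗ[ℂ] F.Piece (i + j) :=
  Submodule.liftQ _
    ((Submodule.liftQ _ ((F.spaceBracket i j).compr₂ (Submodule.mkQ _)).flip (by
      intro y hy
      ext x
      exact (Submodule.Quotient.mk_eq_zero _).2 (F.lie_mem_right x.2 hy))).flip) (by
    intro x hx
    ext y
    exact (Submodule.Quotient.mk_eq_zero _).2 (F.lie_mem_left hx y.2))

/-- The associated graded space `⨁_{j ≥ 1} F_j / F_{j-1}`. -/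
def Gr : Type u := ⨁ j : ℕ+, F.Piece j

instance : AddCommGroup F.Gr := inferInstanceAs (AddCommGroup (⨁ j : ℕ+, F.Piece j))

instance : Module ℂ F.Gr := inferInstanceAs (Module ℂ (⨁ j : ℕ+, F.Piece j))

namespace Gr

/-- The inclusion of the homogeneous component of degree `j`. -/
def incl (j : ℕ+) : F.Piece j →ₗ[ℂ] F.Gr := DirectSum.lof ℂ ℕ+ F.Piece j

/-- The homogeneous component `Gr_j` of degree `j`. -/
def component (j : ℕ+) : Submodule ℂ F.Gr := LinearMap.range (incl F j)

/-- The class `[x]_j` of `x ∈ F_j`. -/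
def cls (j : ℕ+) (x : L) (hx : x ∈ F.space j) : F.Gr :=
  incl F j (Submodule.Quotient.mk ⟨x, hx⟩)

/-- The linear map out of the associated graded space given by linear maps out of the `Gr_j`. -/
def desc {M : Type*} [AddCommGroup M] [Module ℂ M] (g : ∀ j : ℕ+, F.Piece j →ₗ[ℂ] M) :
    F.Gr →ₗ[ℂ] M :=
  DirectSum.toModule ℂ ℕ+ M g

theorem desc_incl {M : Type*} [AddCommGroup M] [Module ℂ M] (g : ∀ j : ℕ+, F.Piece j →ₗ[ℂ] M)
    (j : ℕ+) (x : F.Piece j) : desc F g (incl F j x) = g j x :=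
  DirectSum.toModule_lof ℂ j x

/-- The bracket of the associated graded Lie algebra, as a bilinear map. -/
def bracketMap : F.Gr →ₗ[ℂ] F.Gr →ₗ[ℂ] F.Gr :=
  desc F fun i => (desc F fun j => ((F.pieceBracket i j).compr₂ (incl F (i + j))).flip).flip

theorem bracketMap_incl (i j : ℕ+) (x : F.Piece i) (y : F.Piece j) :
    bracketMap F (incl F i x) (incl F j y) = incl F (i + j) (F.pieceBracket i j x y) := by
  rw [bracketMap, desc_incl, LinearMap.flip_apply, desc_incl]
  rfl

theorem bracketMap_cls {i j : ℕ+} {x y : L} (hx : x ∈ F.space i) (hy : y ∈ F.space j) :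
    bracketMap F (cls F i x hx) (cls F j y hy) = cls F (i + j) ⁅x, y⁆ (F.lie_mem_both hx hy) :=
  bracketMap_incl F i j _ _

theorem cls_congr {i j : ℕ+} {x y : L} (hij : i = j) (hxy : x = y) (hx : x ∈ F.space i)
    (hy : y ∈ F.space j) : cls F i x hx = cls F j y hy := by
  subst hij hxy; rfl

theorem cls_add {i : ℕ+} {x y : L} (hx : x ∈ F.space i) (hy : y ∈ F.space i) :
    cls F i (x + y) (add_mem hx hy) = cls F i x hx + cls F i y hy :=
  map_add ((incl F i).comp ((F.space ((i : ℕ) - 1)).submoduleOf (F.space i)).mkQ)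
    ⟨x, hx⟩ ⟨y, hy⟩

theorem cls_neg {i : ℕ+} {x : L} (hx : x ∈ F.space i) :
    cls F i (-x) (neg_mem hx) = -cls F i x hx :=
  map_neg ((incl F i).comp ((F.space ((i : ℕ) - 1)).submoduleOf (F.space i)).mkQ) ⟨x, hx⟩

theorem induction {p : F.Gr → Prop} (h0 : p 0) (hadd : ∀ x y, p x → p y → p (x + y))
    (hcls : ∀ (i : ℕ+) (x : L) (hx : x ∈ F.space i), p (cls F i x hx)) (x : F.Gr) : p x := by
  refine DirectSum.induction_on (motive := p) x h0 (fun i y => ?_) hadd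
  obtain ⟨y, rfl⟩ := Submodule.Quotient.mk_surjective _ y
  exact hcls i y.1 y.2

theorem bracketMap_skew (x y : F.Gr) : bracketMap F x y = -bracketMap F y x := by
  induction x using induction with
  | h0 => simp
  | hadd x x' hx hx' => simp only [map_add, LinearMap.add_apply, hx, hx']; abel
  | hcls i x hx =>
    induction y using induction with
    | h0 => simp
    | hadd y y' hy hy' => simp only [map_add, LinearMap.add_apply, hy, hy']; abel
    | hcls j y hy =>
      rw [bracketMap_cls, bracketMap_cls, ← cls_neg]
      exact cls_congr F (add_comm i j) (lie_skew x y).symm _ _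

theorem bracketMap_leibniz (x y z : F.Gr) :
    bracketMap F x (bracketMap F y z) =
      bracketMap F (bracketMap F x y) z + bracketMap F y (bracketMap F x z) := by
  induction x using induction with
  | h0 => simp
  | hadd x x' hx hx' => simp only [map_add, LinearMap.add_apply, hx, hx']; abel
  | hcls i x hx =>
    induction y using induction with
    | h0 => simp
    | hadd y y' hy hy' => simp only [map_add, LinearMap.add_apply, hy, hy']; abel
    | hcls j y hy =>
      induction z using induction with
      | h0 => simp
      | hadd z z' hz hz' => simp only [map_add, hz, hz']; abel
      | hcls k z hz =>
        simp only [bracketMap_cls]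
        have h1 : ⁅⁅x, y⁆, z⁆ ∈ F.space ((i + (j + k) : ℕ+) : ℕ) := by
          rw [← add_assoc]; exact F.lie_mem_both (F.lie_mem_both hx hy) hz
        have h2 : ⁅y, ⁅x, z⁆⁆ ∈ F.space ((i + (j + k) : ℕ+) : ℕ) := by
          rw [add_left_comm]; exact F.lie_mem_both hy (F.lie_mem_both hx hz)
        rw [cls_congr F (add_assoc i j k) rfl _ h1, cls_congr F (add_left_comm j i k) rfl _ h2,
          ← cls_add]
        exact cls_congr F rfl (leibniz_lie x y z) _ _

instance : LieRing F.Gr where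
  bracket x y := bracketMap F x y
  add_lie x y z := by
    change bracketMap F (x + y) z = bracketMap F x z + bracketMap F y z
    rw [map_add, LinearMap.add_apply]
  lie_add x y z := map_add (bracketMap F x) y z
  lie_self x := by
    have h : (2 : ℂ) • bracketMap F x x = 0 := by
      rw [two_smul]
      exact eq_neg_iff_add_eq_zero.1 (bracketMap_skew F x x)
    exact (smul_eq_zero.1 h).resolve_left two_ne_zero
  leibniz_lie x y z := bracketMap_leibniz F x y z

instance : LieAlgebra ℂ F.Gr where
  lie_smul c x y := map_smul (bracketMap F x) c y

theorem lie_cls {i j : ℕ+} {x y : L} (hx : x ∈ F.space i) (hy : y ∈ F.space j) :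
    ⁅cls F i x hx, cls F j y hy⁆ = cls F (i + j) ⁅x, y⁆ (F.lie_mem_both hx hy) :=
  bracketMap_cls F hx hy

end Gr

end LieFiltration

/-! ### The filtration by the length of brackets of generators -/

section NestedBrackets

variable {ι : Type v} {L : Type u} [LieRing L] [LieAlgebra ℂ L] (b : ι → L)

/-- The bracket `[b i₁, […, [b iₘ₋₁, b iₘ]…]]`, where `i = i₁` and `l = [i₂, …, iₘ]`. -/
def nestedBracket : ι → List ι → L
  | i, [] => b i
  | i, j :: l => ⁅b i, nestedBracket j l⁆

/-- The span of the nested brackets of at most `j` generators. -/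
def bracketSpan (j : ℕ) : Submodule ℂ L :=
  Submodule.span ℂ {x | ∃ (i : ι) (l : List ι), l.length + 1 ≤ j ∧ x = nestedBracket b i l}

theorem bracketSpan_mono : Monotone (bracketSpan b) := fun _ _ hjk =>
  Submodule.span_mono fun _ ⟨i, l, hl, hx⟩ => ⟨i, l, hl.trans hjk, hx⟩

theorem bracketSpan_zero : bracketSpan b 0 = ⊥ := by
  refine Submodule.span_eq_bot.2 ?_
  rintro x ⟨i, l, hl, -⟩
  omega

theorem gen_mem_bracketSpan (i : ι) {j : ℕ} (hj : 1 ≤ j) : b i ∈ bracketSpan b j :=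
  Submodule.subset_span ⟨i, [], hj, rfl⟩

theorem gen_lie_mem_bracketSpan (i : ι) {j : ℕ} {y : L} (hy : y ∈ bracketSpan b j) :
    ⁅b i, y⁆ ∈ bracketSpan b (j + 1) := by
  induction hy using Submodule.span_induction with
  | mem y hy =>
    obtain ⟨k, l, hl, rfl⟩ := hy
    exact Submodule.subset_span ⟨i, k :: l, by simpa using hl, rfl⟩
  | zero => simp
  | add y z _ _ hy hz => rw [lie_add]; exact add_mem hy hz
  | smul c y _ hy => rw [lie_smul]; exact Submodule.smul_mem _ c hy

theorem nested_lie_mem_bracketSpan (l : List ι) : ∀ (i : ι) {j : ℕ} {y : L},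
    y ∈ bracketSpan b j → ⁅nestedBracket b i l, y⁆ ∈ bracketSpan b (l.length + 1 + j) := by
  induction l with
  | nil =>
    intro i j y hy
    rw [List.length_nil, zero_add, add_comm]
    exact gen_lie_mem_bracketSpan b i hy
  | cons k l ih =>
    intro i j y hy
    rw [nestedBracket, lie_lie]
    refine sub_mem ?_ ?_
    · have := gen_lie_mem_bracketSpan b i (ih k hy)
      rwa [List.length_cons, add_right_comm _ 1 j]
    · have := ih k (gen_lie_mem_bracketSpan b i hy)
      rwa [List.length_cons, show l.length + 1 + 1 + j = l.length + 1 + (j + 1) by omega]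

theorem lie_mem_bracketSpan {i j : ℕ} {x y : L} (hx : x ∈ bracketSpan b i)
    (hy : y ∈ bracketSpan b j) : ⁅x, y⁆ ∈ bracketSpan b (i + j) := by
  induction hx using Submodule.span_induction with
  | mem x hx =>
    obtain ⟨k, l, hl, rfl⟩ := hx
    exact bracketSpan_mono b (by omega) (nested_lie_mem_bracketSpan b l k hy)
  | zero => simp
  | add x z _ _ hx hz => rw [add_lie]; exact add_mem hx hz
  | smul c x _ hx => rw [smul_lie]; exact Submodule.smul_mem _ c hx

/-- The filtration of a Lie algebra by the number of generators in nested brackets. -/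
def bracketFiltration (hb : LieSubalgebra.lieSpan ℂ L (Set.range b) = ⊤) : LieFiltration L where
  space := bracketSpan b
  mono := bracketSpan_mono b
  space_zero := bracketSpan_zero b
  exhaustive x := by
    have hx : x ∈ LieSubalgebra.lieSpan ℂ L (Set.range b) := hb ▸ LieSubalgebra.mem_top x
    induction hx using LieSubalgebra.lieSpan_induction with
    | mem x hx => obtain ⟨i, rfl⟩ := hx; exact ⟨1, gen_mem_bracketSpan b i le_rfl⟩
    | zero => exact ⟨0, zero_mem _⟩
    | add x y _ _ hx hy =>
      obtain ⟨i, hi⟩ := hx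
      obtain ⟨j, hj⟩ := hy
      exact ⟨i + j, add_mem (bracketSpan_mono b (by omega) hi) (bracketSpan_mono b (by omega) hj)⟩
    | smul c x _ hx => obtain ⟨i, hi⟩ := hx; exact ⟨i, Submodule.smul_mem _ c hi⟩
    | lie x y _ _ hx hy =>
      obtain ⟨i, hi⟩ := hx
      obtain ⟨j, hj⟩ := hy
      exact ⟨i + j, lie_mem_bracketSpan b hi hj⟩
  lie_mem := lie_mem_bracketSpan b

end NestedBrackets

namespace OnsagerAlgebra

variable {n : ℕ} (A : Matrix (Fin n) (Fin n) ℤ)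

/-- The filtration of `ℒ(A)` by the spans `ℒ_j(A)` of the brackets
`[B_{i₁}, […, [B_{iₘ₋₁}, B_{iₘ}]…]]` with `m ≤ j`. -/
def filtration : LieFiltration (OnsagerAlgebra A) :=
  bracketFiltration (B A) PresentedLieAlgebra.lieSpan_range_of

theorem B_mem_filtration (i : Fin n) : B A i ∈ (filtration A).space (1 : ℕ+) :=
  gen_mem_bracketSpan (B A) i le_rfl

end OnsagerAlgebra

end

/-! Let N be the Lie algebra on e_1, …, e_n presented by the Serre relations alone (`SerreAlgebra`).
Both parts come from comparing leading terms in N, ℒ(A) and 𝔤(A).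

N embeds in 𝔤(A) with image 𝔫(A) (`toKacMoody_injective`, `toNilpotentPart_bijective`). To see this,
𝔤(A) is made to act on N ⊕ 𝔥 ⊕ N by the formulas that its adjoint representation has to obey. Choose
ρ ∈ 𝔥 with α_i(ρ) = 1 for all i. The image of x ∈ N sends ρ to -[ρ, x], and ρ multiplies a bracket
of m ≥ 1 generators by m, so x can be recovered from its action.

The map ψ exists because of `onsagerSum_Y`. With z_r = (ad e_i)^r e_j, the action of ad Y_i on the
elements z_r + ω(z_r) obeys the three-term recursion that defines the coefficients c. The Onsager
relation therefore evaluates to z_r + ω(z_r) at r = 1 - a_ij, which the Serre relation kills.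
Surjectivity follows from 𝔤 = 𝔥 + 𝔫 + ω(𝔫): fixed points are sums z + ω(z) with z ∈ 𝔫, and these are
reached by induction on bracket length (`symmetrization_mem_range`).

The map N → Gr(ℒ(A)) exists because the leading term of an Onsager relation is a Serre relation
(`ad_grB_serre`). It is onto because both sides are spanned by nested brackets of generators.

Injectivity of both maps rests on `nestedBracket_Y_sub_mem`: a nested bracket of m elements Y_i is
the same bracket of the e_i plus terms of height below m. If a combination of length-j brackets of
the B_i has an image under ψ with heights below j only, the same combination u in N has an image in
𝔤 that is of height j and also of heights below j. That image is zero, so u = 0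
(`eq_zero_of_pairSpan`). Descending along the filtration makes both ψ and N → Gr injective, and φ is
the latter composed with 𝔫(A) ≅ N. -/

noncomputable section

universe u v

/-! ### Free and presented Lie algebras -/

theorem FreeLieAlgebra.lieSpan_range_of {X : Type u} :
    LieSubalgebra.lieSpan ℂ _ (Set.range (FreeLieAlgebra.of ℂ (X := X))) = ⊤ := by
  set K := LieSubalgebra.lieSpan ℂ _ (Set.range (FreeLieAlgebra.of ℂ (X := X)))
  let g : X → K := fun x => ⟨FreeLieAlgebra.of ℂ x, LieSubalgebra.subset_lieSpan ⟨x, rfl⟩⟩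
  have hK : K.incl.comp (FreeLieAlgebra.lift ℂ g) = LieHom.id :=
    FreeLieAlgebra.hom_ext fun x => by
      rw [LieHom.comp_apply, FreeLieAlgebra.lift_of_apply]; rfl
  refine eq_top_iff.2 fun x _ => ?_
  have := (FreeLieAlgebra.lift ℂ g x).2
  rwa [show ((FreeLieAlgebra.lift ℂ g x : K) : FreeLieAlgebra ℂ X) = x from
    LieHom.congr_fun hK x] at this

/-! ### Spans of nested brackets of a fixed length -/

section ExactSpan

variable {ι : Type v} {L : Type u} [LieRing L] [LieAlgebra ℂ L] (b : ι → L)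

/-- The span of the nested brackets of exactly `j` generators. -/
def exactBracketSpan (j : ℕ) : Submodule ℂ L :=
  Submodule.span ℂ {x | ∃ (i : ι) (l : List ι), l.length + 1 = j ∧ x = nestedBracket b i l}

variable {b}

theorem exactBracketSpan_le (j : ℕ) : exactBracketSpan b j ≤ bracketSpan b j :=
  Submodule.span_mono fun _ ⟨i, l, hl, hx⟩ => ⟨i, l, hl.le, hx⟩

theorem bracketSpan_succ_le (j : ℕ) :
    bracketSpan b (j + 1) ≤ exactBracketSpan b (j + 1) ⊔ bracketSpan b j := by
  refine Submodule.span_le.2 ?_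
  rintro _ ⟨i, l, hl, rfl⟩
  rcases hl.eq_or_lt with h | h
  · exact Submodule.mem_sup_left (Submodule.subset_span ⟨i, l, h, rfl⟩)
  · exact Submodule.mem_sup_right (Submodule.subset_span ⟨i, l, by omega, rfl⟩)

theorem bracketSpan_le_iSup (j : ℕ) : bracketSpan b j ≤ ⨆ k, exactBracketSpan b k := by
  refine Submodule.span_le.2 ?_
  rintro _ ⟨i, l, hl, rfl⟩
  exact Submodule.mem_iSup_of_mem (l.length + 1) (Submodule.subset_span ⟨i, l, rfl, rfl⟩)

theorem exists_mem_bracketSpan {x : L} (hx : x ∈ LieSubalgebra.lieSpan ℂ L (Set.range b)) :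
    ∃ j, x ∈ bracketSpan b j := by
  induction hx using LieSubalgebra.lieSpan_induction with
  | mem x hx => obtain ⟨i, rfl⟩ := hx; exact ⟨1, gen_mem_bracketSpan b i le_rfl⟩
  | zero => exact ⟨0, zero_mem _⟩
  | add x y _ _ hx hy =>
    obtain ⟨i, hi⟩ := hx
    obtain ⟨j, hj⟩ := hy
    exact ⟨i + j, add_mem (bracketSpan_mono b (by omega) hi) (bracketSpan_mono b (by omega) hj)⟩
  | smul c x _ hx => obtain ⟨i, hi⟩ := hx; exact ⟨i, Submodule.smul_mem _ c hi⟩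
  | lie x y _ _ hx hy =>
    obtain ⟨i, hi⟩ := hx
    obtain ⟨j, hj⟩ := hy
    exact ⟨i + j, lie_mem_bracketSpan b hi hj⟩

theorem nestedBracket_mem_lieSpan (i : ι) (l : List ι) :
    nestedBracket b i l ∈ LieSubalgebra.lieSpan ℂ L (Set.range b) := by
  induction l generalizing i with
  | nil => exact LieSubalgebra.subset_lieSpan ⟨i, rfl⟩
  | cons k l ih => exact LieSubalgebra.lie_mem _ (LieSubalgebra.subset_lieSpan ⟨i, rfl⟩) (ih k)

theorem bracketSpan_le_lieSpan (j : ℕ) :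
    bracketSpan b j ≤ (LieSubalgebra.lieSpan ℂ L (Set.range b)).toSubmodule := by
  refine Submodule.span_le.2 ?_
  rintro _ ⟨i, l, -, rfl⟩
  exact nestedBracket_mem_lieSpan i l

theorem map_nestedBracket {M : Type*} [LieRing M] [LieAlgebra ℂ M] (F : L →ₗ⁅ℂ⁆ M) (i : ι)
    (l : List ι) : F (nestedBracket b i l) = nestedBracket (F ∘ b) i l := by
  induction l generalizing i with
  | nil => rfl
  | cons k l ih => rw [nestedBracket, LieHom.map_lie, ih]; rfl

theorem map_exactBracketSpan {M : Type*} [LieRing M] [LieAlgebra ℂ M] (F : L →ₗ⁅ℂ⁆ M) (j : ℕ) :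
    (exactBracketSpan b j).map F.toLinearMap = exactBracketSpan (F ∘ b) j := by
  rw [exactBracketSpan, Submodule.map_span, exactBracketSpan]
  congr 1
  ext y
  constructor
  · rintro ⟨_, ⟨i, l, hl, rfl⟩, rfl⟩
    exact ⟨i, l, hl, map_nestedBracket F i l⟩
  · rintro ⟨i, l, hl, rfl⟩
    exact ⟨_, ⟨i, l, hl, rfl⟩, map_nestedBracket F i l⟩

/-- A submodule that contains the generators of a Lie algebra and is stable under their adjoint
action is everything. -/
theorem eq_top_of_lie_stable {s : Set L} (hs : LieSubalgebra.lieSpan ℂ L s = ⊤)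
    (S : Submodule ℂ L) (h1 : s ⊆ S) (h2 : ∀ x ∈ s, ∀ y ∈ S, ⁅x, y⁆ ∈ S) : S = ⊤ := by
  -- The elements whose adjoint action preserves `S` form a Lie subalgebra, so stability passes from
  -- the generators to all of `L`.
  have key (x : L) (hx : x ∈ LieSubalgebra.lieSpan ℂ L s) : ∀ y ∈ S, ⁅x, y⁆ ∈ S := by
    induction hx using LieSubalgebra.lieSpan_induction with
    | mem x hx => exact h2 x hx
    | zero => intro y _; simp
    | add x z _ _ hx hz => intro y hy; rw [add_lie]; exact add_mem (hx y hy) (hz y hy)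
    | smul c x _ hx => intro y hy; rw [smul_lie]; exact S.smul_mem c (hx y hy)
    | lie x z _ _ hx hz =>
      intro y hy
      rw [lie_lie]
      exact sub_mem (hx _ (hz y hy)) (hz _ (hx y hy))
  refine eq_top_iff.2 fun x _ => ?_
  have hx : x ∈ LieSubalgebra.lieSpan ℂ L s := hs ▸ LieSubalgebra.mem_top x
  induction hx using LieSubalgebra.lieSpan_induction with
  | mem x hx => exact h1 hx
  | zero => exact zero_mem _
  | add x z _ _ hx hz => exact add_mem (hx trivial) (hz trivial)
  | smul c x _ hx => exact S.smul_mem c (hx trivial)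
  | lie x z hx _ _ hz' => exact key x hx z (hz' trivial)

end ExactSpan

/-! ### Eigenspaces -/

/-- Eigenspaces for distinct eigenvalues are independent, so the part of `x` outside `S k` is an
eigenvector for k lying in the sum of the other eigenspaces, hence zero. -/
theorem mem_of_mem_eigenspace_of_mem_iSup {V : Type*} [AddCommGroup V] [Module ℂ V]
    (T : Module.End ℂ V) (S : ℕ → Submodule ℂ V) (hS : ∀ m, S m ≤ T.eigenspace (m : ℂ)) {k : ℕ}
    {x : V} (hx : x ∈ T.eigenspace (k : ℂ)) (hx' : x ∈ ⨆ m, S m) : x ∈ S k := by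
  rw [iSup_split_single S k] at hx'
  obtain ⟨s, hs, t, ht, rfl⟩ := Submodule.mem_sup.1 hx'
  have h1 : t ∈ T.eigenspace (k : ℂ) := by
    have := sub_mem hx (hS k hs)
    rwa [add_sub_cancel_left] at this
  have h2 : t ∈ ⨆ μ, ⨆ (_ : μ ≠ (k : ℂ)), T.eigenspace μ := by
    refine SetLike.le_def.1 (iSup₂_le fun m hm => ?_) ht
    exact (hS m).trans (le_iSup₂_of_le (m : ℂ) (by exact_mod_cast hm) le_rfl)
  have h3 : t = 0 := Submodule.disjoint_def.1 (T.eigenspaces_iSupIndep (k : ℂ)) t h1 h2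
  rwa [h3, add_zero]

/-- The sum of the eigenspaces for the integral eigenvalues `m < j`. -/
def lowerEigenspaces {V : Type*} [AddCommGroup V] [Module ℂ V] (T : Module.End ℂ V) (j : ℤ) :
    Submodule ℂ V :=
  ⨆ (m : ℤ) (_ : m < j), T.eigenspace (m : ℂ)

section LowerEigenspaces

variable {V : Type*} [AddCommGroup V] [Module ℂ V] {T : Module.End ℂ V}

theorem lowerEigenspaces_mono {i j : ℤ} (h : i ≤ j) :
    lowerEigenspaces T i ≤ lowerEigenspaces T j :=
  iSup₂_le fun m hm => le_iSup₂_of_le m (hm.trans_le h) le_rfl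

theorem eigenspace_le_lowerEigenspaces {m j : ℤ} (h : m < j) :
    T.eigenspace (m : ℂ) ≤ lowerEigenspaces T j :=
  le_iSup₂_of_le m h le_rfl

theorem eq_zero_of_mem_lowerEigenspaces {j : ℤ} {x : V} (hx : x ∈ T.eigenspace (j : ℂ))
    (hx' : x ∈ lowerEigenspaces T j) : x = 0 := by
  refine Submodule.disjoint_def.1 (T.eigenspaces_iSupIndep (j : ℂ)) x hx ?_
  refine SetLike.le_def.1 (iSup₂_le fun m hm => ?_) hx'
  exact le_iSup₂_of_le (m : ℂ) (by exact_mod_cast hm.ne) le_rfl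

theorem map_mem_lowerEigenspaces {E : V →ₗ[ℂ] V} {d j : ℤ}
    (hE : ∀ m : ℤ, ∀ x ∈ T.eigenspace (m : ℂ), E x ∈ T.eigenspace ((m + d : ℤ) : ℂ)) {x : V}
    (hx : x ∈ lowerEigenspaces T j) : E x ∈ lowerEigenspaces T (j + d) := by
  have : lowerEigenspaces T j ≤ (lowerEigenspaces T (j + d)).comap E :=
    iSup₂_le fun m hm x hx => eigenspace_le_lowerEigenspaces (by omega) (hE m x hx)
  exact this hx

end LowerEigenspaces

/-! ### Brackets of iterated adjoint actions -/

/-- This is the sl₂ computation, with 2m + a the weight of the m-th vector of an e-string: the sum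
of 2l + a for l = 0, …, m is (m + 1)(m + a). The result vanishes at m = -a, which is the reason for
the exponent 1 - a in the Serre relations. It is used for `ad f_i` and again for contractions. -/
theorem recursion_of_weights {M : Type*} [AddCommGroup M] [Module ℂ M] (E : M →ₗ[ℂ] M) (a : ℂ)
    (x y : ℕ → M) (hx : ∀ m, x (m + 1) = E (x m)) (hy0 : y 0 = 0)
    (hy : ∀ m, y (m + 1) = E (y m) - (2 * m + a) • x m) (m : ℕ) :
    y (m + 1) = -((m + 1) * (m + a)) • x m := by
  induction m with
  | zero => rw [hy, hy0]; simp
  | succ m ih =>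
    rw [hy, ih, map_smul, ← hx, ← sub_smul]
    congr 1
    push_cast
    ring

section Triples

variable {ι : Type*} [DecidableEq ι] {L : Type u} [LieRing L] [LieAlgebra ℂ L]
  {A : Matrix ι ι ℤ} {e f h : ι → L}

theorem lie_ad_pow_weight {L : Type*} [LieRing L] [LieAlgebra ℂ L] {x y z : L} {p q : ℂ}
    (hy : ⁅x, y⁆ = p • y) (hz : ⁅x, z⁆ = q • z) (m : ℕ) :
    ⁅x, ((LieAlgebra.ad ℂ L y) ^ m) z⁆ = (m * p + q) • ((LieAlgebra.ad ℂ L y) ^ m) z := by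
  induction m with
  | zero => simp [hz]
  | succ m ih =>
    rw [pow_succ', Module.End.mul_apply, LieAlgebra.ad_apply, leibniz_lie, hy, ih, lie_smul,
      smul_lie, ← add_smul]
    congr 1
    push_cast
    ring

theorem lie_ad_pow_same (hhe : ∀ i j, ⁅h i, e j⁆ = (A i j : ℂ) • e j)
    (hef : ∀ i j, ⁅e i, f j⁆ = if i = j then h i else 0) (hA : ∀ i, A i i = 2) {i j : ι}
    (hij : i ≠ j) (m : ℕ) :
    ⁅f i, ((LieAlgebra.ad ℂ L (e i)) ^ (m + 1)) (e j)⁆ =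
      -((m + 1) * (m + (A i j : ℂ))) • ((LieAlgebra.ad ℂ L (e i)) ^ m) (e j) := by
  refine recursion_of_weights (LieAlgebra.ad ℂ L (e i)) (A i j)
    (fun m => ((LieAlgebra.ad ℂ L (e i)) ^ m) (e j))
    (fun m => ⁅f i, ((LieAlgebra.ad ℂ L (e i)) ^ m) (e j)⁆) (fun m => ?_) ?_ (fun m => ?_) m
  · rw [pow_succ', Module.End.mul_apply]
  · change ⁅f i, e j⁆ = 0
    rw [← lie_skew, hef, if_neg hij.symm, neg_zero]
  · have hw := lie_ad_pow_weight (hhe i i) (hhe i j) m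
    rw [hA] at hw
    simp only [pow_succ', Module.End.mul_apply, LieAlgebra.ad_apply]
    rw [leibniz_lie, ← lie_skew (f i) (e i), hef, if_pos rfl, neg_lie, hw]
    push_cast
    rw [mul_comm (2 : ℂ)]
    abel

/-- Serre elements commute with every f_k already before the Serre relations are imposed. For k = i
this is the sl₂ computation; for k ≠ i, ad f_k commutes with ad e_i and only [f_k, e_j] matters. -/
theorem lie_serre_eq_zero (hhe : ∀ i j, ⁅h i, e j⁆ = (A i j : ℂ) • e j)
    (hef : ∀ i j, ⁅e i, f j⁆ = if i = j then h i else 0) (hA : ∀ i, A i i = 2)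
    (hA' : ∀ i j, i ≠ j → A i j ≤ 0) (hA0 : ∀ i j, A i j = 0 → A j i = 0) {i j : ι}
    (hij : i ≠ j) (k : ι) :
    ⁅f k, ((LieAlgebra.ad ℂ L (e i)) ^ (1 - A i j).toNat) (e j)⁆ = 0 := by
  obtain ⟨m, hm⟩ : ∃ m : ℕ, A i j = -m := ⟨(-A i j).toNat, by have := hA' i j hij; omega⟩
  have hr : (1 - A i j).toNat = m + 1 := by omega
  rw [hr]
  by_cases hki : k = i
  · subst hki
    rw [lie_ad_pow_same hhe hef hA hij, hm]
    simp
  · have hfe : ⁅f k, e i⁆ = 0 := by rw [← lie_skew, hef, if_neg (Ne.symm hki), neg_zero]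
    have comm (m : ℕ) (z : L) : ⁅f k, ((LieAlgebra.ad ℂ L (e i)) ^ m) z⁆ =
        ((LieAlgebra.ad ℂ L (e i)) ^ m) ⁅f k, z⁆ := by
      induction m with
      | zero => rfl
      | succ m ih =>
        rw [pow_succ', Module.End.mul_apply, LieAlgebra.ad_apply, leibniz_lie, hfe, ih, zero_lie,
          zero_add]
        rfl
    rw [comm]
    by_cases hkj : k = j
    · subst hkj
      rw [← lie_skew, hef, if_pos rfl, map_neg, pow_succ, Module.End.mul_apply,
        LieAlgebra.ad_apply, ← lie_skew, hhe]
      -- What remains is a_ji (ad e_i)^m e_i. It vanishes for m ≥ 1, and for m = 0 one has a_ij = 0,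
      -- hence a_ji = 0.
      cases m with
      | zero => simp [hA0 i k (by simpa using hm)]
      | succ m => simp [pow_succ]
    · rw [← lie_skew, hef, if_neg (Ne.symm hkj)]
      simp

end Triples

/-! ### Derivations of presented Lie algebras -/

/-- The split extension of a Lie algebra `L` by an `L`-module `M`, regarded as an abelian ideal. -/
@[ext]
structure SplitExtension (L : Type u) (M : Type v) where
  /-- the component in the Lie algebra -/
  fst : L
  /-- the component in the module -/
  snd : M

namespace SplitExtension

variable {L : Type u} {M : Type v}

/-- The split extension is a product as a vector space. -/
def equivProd (L : Type u) (M : Type v) : SplitExtension L M ≃ L × M where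
  toFun x := (x.fst, x.snd)
  invFun x := ⟨x.1, x.2⟩
  left_inv _ := rfl
  right_inv _ := rfl

section Module

variable [AddCommGroup L] [Module ℂ L] [AddCommGroup M] [Module ℂ M]

instance : AddCommGroup (SplitExtension L M) := (equivProd L M).addCommGroup

instance : Module ℂ (SplitExtension L M) := (equivProd L M).module ℂ

@[simp] theorem fst_smul (c : ℂ) (x : SplitExtension L M) : (c • x).fst = c • x.fst := rfl

@[simp] theorem snd_smul (c : ℂ) (x : SplitExtension L M) : (c • x).snd = c • x.snd := rfl

end Module

variable [LieRing L] [AddCommGroup M]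

@[simp] theorem fst_add (x y : SplitExtension L M) : (x + y).fst = x.fst + y.fst := rfl

@[simp] theorem snd_add (x y : SplitExtension L M) : (x + y).snd = x.snd + y.snd := rfl

@[simp] theorem fst_zero : (0 : SplitExtension L M).fst = 0 := rfl

@[simp] theorem snd_zero : (0 : SplitExtension L M).snd = 0 := rfl

variable [LieRingModule L M]

instance : Bracket (SplitExtension L M) (SplitExtension L M) where
  bracket x y := ⟨⁅x.fst, y.fst⁆, ⁅x.fst, y.snd⁆ - ⁅y.fst, x.snd⁆⟩

@[simp] theorem fst_lie (x y : SplitExtension L M) : ⁅x, y⁆.fst = ⁅x.fst, y.fst⁆ := rfl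

@[simp] theorem snd_lie (x y : SplitExtension L M) :
    ⁅x, y⁆.snd = ⁅x.fst, y.snd⁆ - ⁅y.fst, x.snd⁆ := rfl

instance : LieRing (SplitExtension L M) where
  add_lie x y z := by ext <;> simp; abel
  lie_add x y z := by ext <;> simp; abel
  lie_self x := by ext <;> simp
  leibniz_lie x y z := by ext <;> simp; abel

variable [LieAlgebra ℂ L] [Module ℂ M] [LieModule ℂ L M]

instance : LieAlgebra ℂ (SplitExtension L M) where
  lie_smul c x y := by ext <;> simp [smul_sub]

/-- The projection to the Lie algebra. -/
def fstHom (L : Type u) (M : Type v) [LieRing L] [LieAlgebra ℂ L] [AddCommGroup M] [Module ℂ M]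
    [LieRingModule L M] [LieModule ℂ L M] : SplitExtension L M →ₗ⁅ℂ⁆ L where
  toFun := fst
  map_add' _ _ := rfl
  map_smul' _ _ := rfl
  map_lie' := rfl

theorem fst_ad_pow (x y : SplitExtension L M) (k : ℕ) :
    (((LieAlgebra.ad ℂ _ x) ^ k) y).fst = ((LieAlgebra.ad ℂ L x.fst) ^ k) y.fst :=
  KacMoodyAlgebra.map_ad_pow (fstHom L M) x y k

theorem snd_ad_pow_succ (x y : SplitExtension L M) (k : ℕ) :
    (((LieAlgebra.ad ℂ _ x) ^ (k + 1)) y).snd =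
      ⁅x.fst, (((LieAlgebra.ad ℂ _ x) ^ k) y).snd⁆ -
        ⁅((LieAlgebra.ad ℂ L x.fst) ^ k) y.fst, x.snd⁆ := by
  rw [pow_succ', Module.End.mul_apply, LieAlgebra.ad_apply, snd_lie, fst_ad_pow]

end SplitExtension

namespace PresentedLieAlgebra

variable {X : Type u} {rels : Set (FreeLieAlgebra ℂ X)} {M : Type v} [AddCommGroup M] [Module ℂ M]
  [LieRingModule (PresentedLieAlgebra rels) M] [LieModule ℂ (PresentedLieAlgebra rels) M]

/-- The derivation of a presented Lie algebra with prescribed values on the generators. -/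
def derivation (f : X → M)
    (hf : ∀ r ∈ rels, FreeLieAlgebra.lift ℂ
      (fun x => (⟨of rels x, f x⟩ : SplitExtension (PresentedLieAlgebra rels) M)) r = 0) :
    LieDerivation ℂ (PresentedLieAlgebra rels) M :=
  -- A map D into a module is a derivation exactly when x ↦ (x, D x) is a homomorphism to the split
  -- extension. Hence the universal property of the presentation, which speaks of homomorphisms,
  -- also produces derivations.
  have hF (x : PresentedLieAlgebra rels) : (lift _ hf x).fst = x :=
    LieHom.congr_fun (f := (SplitExtension.fstHom _ M).comp (lift _ hf)) (g := LieHom.id)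
      (hom_ext fun x => congrArg SplitExtension.fst (lift_of _ hf x)) x
  { toFun := fun x => (lift _ hf x).snd
    map_add' := fun x y => by rw [map_add, SplitExtension.snd_add]
    map_smul' := fun c x => by rw [map_smul, SplitExtension.snd_smul]; rfl
    leibniz' := fun x y => by
      change (lift _ hf ⁅x, y⁆).snd = ⁅x, (lift _ hf y).snd⁆ - ⁅y, (lift _ hf x).snd⁆
      rw [LieHom.map_lie, SplitExtension.snd_lie, hF, hF] }

theorem derivation_of (f : X → M)
    (hf : ∀ r ∈ rels, FreeLieAlgebra.lift ℂ
      (fun x => (⟨of rels x, f x⟩ : SplitExtension (PresentedLieAlgebra rels) M)) r = 0) (x : X) :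
    derivation f hf (of rels x) = f x :=
  congrArg SplitExtension.snd (lift_of _ hf x)

theorem derivation_ext {D D' : LieDerivation ℂ (PresentedLieAlgebra rels) M}
    (h : ∀ x, D (of rels x) = D' (of rels x)) : D = D' :=
  LieDerivation.ext_of_lieSpan_eq_top _ lieSpan_range_of (by rintro _ ⟨x, rfl⟩; exact h x)

end PresentedLieAlgebra

/-! ### The Lie algebra presented by the Serre relations -/

section Serre

variable {n : ℕ} (A : Matrix (Fin n) (Fin n) ℤ)

/-- The Serre relations. -/
inductive SerreRelation : FreeLieAlgebra ℂ (Fin n) → Prop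
  | serre (i j : Fin n) (hij : i ≠ j) : SerreRelation
      (((LieAlgebra.ad ℂ _ (FreeLieAlgebra.of ℂ i)) ^ (1 - A i j).toNat) (FreeLieAlgebra.of ℂ j))

/-- The Lie algebra presented by the Serre relations. -/
abbrev SerreAlgebra : Type := PresentedLieAlgebra {r | SerreRelation A r}

namespace SerreAlgebra

/-- The generators. -/
def e (i : Fin n) : SerreAlgebra A := PresentedLieAlgebra.of _ i

theorem ad_e_pow {i j : Fin n} (hij : i ≠ j) :
    ((LieAlgebra.ad ℂ _ (e A i)) ^ (1 - A i j).toNat) (e A j) = 0 := by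
  have := PresentedLieAlgebra.mk_eq_zero (rels := {r | SerreRelation A r}) (.serre i j hij)
  rwa [KacMoodyAlgebra.map_ad_pow] at this

variable {A}

theorem lift_serre {L : Type*} [LieRing L] [LieAlgebra ℂ L] (g : Fin n → L)
    (hg : ∀ i j, i ≠ j → ((LieAlgebra.ad ℂ _ (g i)) ^ (1 - A i j).toNat) (g j) = 0) :
    ∀ r ∈ {r | SerreRelation A r}, FreeLieAlgebra.lift ℂ g r = 0 := by
  rintro _ ⟨i, j, hij⟩
  rw [KacMoodyAlgebra.map_ad_pow, FreeLieAlgebra.lift_of_apply, FreeLieAlgebra.lift_of_apply,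
    hg i j hij]

theorem induction {p : SerreAlgebra A → Prop} (h0 : p 0) (he : ∀ i, p (e A i))
    (hadd : ∀ x y, p x → p y → p (x + y)) (hsmul : ∀ (c : ℂ) x, p x → p (c • x))
    (hlie : ∀ i x, p x → p ⁅e A i, x⁆) (x : SerreAlgebra A) : p x := by
  let S : Submodule ℂ (SerreAlgebra A) :=
    { carrier := {x | p x}
      zero_mem' := h0
      add_mem' := fun {x y} hx hy => hadd x y hx hy
      smul_mem' := fun c x hx => hsmul c x hx }
  have hS : S = ⊤ := eq_top_of_lie_stable PresentedLieAlgebra.lieSpan_range_of S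
    (by rintro _ ⟨i, rfl⟩; exact he i) (by rintro _ ⟨i, rfl⟩ y hy; exact hlie i y hy)
  exact (hS ▸ Submodule.mem_top : x ∈ S)

end SerreAlgebra

variable {A}
variable {𝔥 : Type u} [AddCommGroup 𝔥] [Module ℂ 𝔥] (R : CartanRealization A 𝔥)

namespace SerreAlgebra

/-- The action of `h ∈ 𝔥`, for which `eᵢ` has weight `αᵢ`. -/
def weightDerivation (h : 𝔥) : LieDerivation ℂ (SerreAlgebra A) (SerreAlgebra A) :=
  PresentedLieAlgebra.derivation (fun i => R.root i h • e A i) (lift_serre _ fun i j hij => by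
    set x : SplitExtension (SerreAlgebra A) (SerreAlgebra A) := ⟨e A i, R.root i h • e A i⟩ with hx
    set y : SplitExtension (SerreAlgebra A) (SerreAlgebra A) := ⟨e A j, R.root j h • e A j⟩ with hy
    change ((LieAlgebra.ad ℂ _ x) ^ (1 - A i j).toNat) y = 0
    have key (m : ℕ) : (((LieAlgebra.ad ℂ _ x) ^ m) y).snd =
        (m * R.root i h + R.root j h) • ((LieAlgebra.ad ℂ _ (e A i)) ^ m) (e A j) := by
      induction m with
      | zero => simp [hy]
      | succ m ih =>
        rw [SplitExtension.snd_ad_pow_succ, ih, pow_succ', Module.End.mul_apply,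
          LieAlgebra.ad_apply, lie_smul]
        change _ • ⁅e A i, _⁆ - ⁅((LieAlgebra.ad ℂ _ (e A i)) ^ m) (e A j), R.root i h • e A i⁆ =
          _ • ⁅e A i, _⁆
        rw [lie_smul, ← lie_skew _ (e A i), smul_neg, sub_neg_eq_add, ← add_smul]
        congr 1
        push_cast
        ring
    ext
    · exact (SplitExtension.fst_ad_pow x y _).trans (ad_e_pow A hij)
    · rw [key, ad_e_pow A hij, smul_zero]; rfl)

theorem weightDerivation_e (h : 𝔥) (i : Fin n) :
    weightDerivation R h (e A i) = R.root i h • e A i :=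
  PresentedLieAlgebra.derivation_of ..

theorem weightDerivation_add (h k : 𝔥) :
    weightDerivation R (h + k) = weightDerivation R h + weightDerivation R k :=
  PresentedLieAlgebra.derivation_ext fun i => by
    change weightDerivation R (h + k) (e A i) =
      weightDerivation R h (e A i) + weightDerivation R k (e A i)
    simp only [weightDerivation_e, map_add, add_smul]

theorem weightDerivation_smul (c : ℂ) (h : 𝔥) :
    weightDerivation R (c • h) = c • weightDerivation R h :=
  PresentedLieAlgebra.derivation_ext fun i => by
    change weightDerivation R (c • h) (e A i) = c • weightDerivation R h (e A i)
    simp only [weightDerivation_e, map_smul, smul_smul, smul_eq_mul]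

theorem weightDerivation_zero : weightDerivation R 0 = 0 := by
  simpa using weightDerivation_smul R 0 0

theorem weightDerivation_neg (h : 𝔥) : weightDerivation R (-h) = -weightDerivation R h := by
  rw [← neg_one_smul ℂ h, weightDerivation_smul, neg_one_smul]

theorem weightDerivation_comm (h k : 𝔥) (x : SerreAlgebra A) :
    weightDerivation R h (weightDerivation R k x) =
      weightDerivation R k (weightDerivation R h x) := by
  have : ⁅weightDerivation R h, weightDerivation R k⁆ = 0 :=
    PresentedLieAlgebra.derivation_ext fun i => by
      change ⁅weightDerivation R h, weightDerivation R k⁆ (e A i) = 0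
      simp only [LieDerivation.commutator_apply, weightDerivation_e, map_smul, smul_smul]
      rw [mul_comm, sub_self]
  have := LieDerivation.congr_fun this x
  rwa [LieDerivation.commutator_apply, LieDerivation.zero_apply, sub_eq_zero] at this

/-- The space `𝔥 ⊕ N`, where `N` is the Lie algebra presented by the Serre relations, as a module
over `N`. -/
@[nolint unusedArguments]
def Borel (_ : CartanRealization A 𝔥) : Type u := 𝔥 × SerreAlgebra A

instance : AddCommGroup (Borel R) := inferInstanceAs (AddCommGroup (𝔥 × SerreAlgebra A))

instance : Module ℂ (Borel R) := inferInstanceAs (Module ℂ (𝔥 × SerreAlgebra A))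

/-- This is the adjoint action of N on the semidirect product 𝔥 ⋉ N: [x, h + y] = [x, y] - h·x, with
no component in 𝔥. -/
instance : LieRingModule (SerreAlgebra A) (Borel R) where
  bracket x b := ((0 : 𝔥), ⁅x, b.2⁆ - weightDerivation R b.1 x)
  add_lie x y b := Prod.ext (add_zero _).symm (by
    change ⁅x + y, b.2⁆ - weightDerivation R b.1 (x + y) =
      ⁅x, b.2⁆ - weightDerivation R b.1 x + (⁅y, b.2⁆ - weightDerivation R b.1 y)
    rw [add_lie, map_add]; abel)
  lie_add x b c := Prod.ext (add_zero _).symm (by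
    change ⁅x, b.2 + c.2⁆ - weightDerivation R (b.1 + c.1) x =
      ⁅x, b.2⁆ - weightDerivation R b.1 x + (⁅x, c.2⁆ - weightDerivation R c.1 x)
    rw [lie_add, weightDerivation_add, LieDerivation.add_apply]; abel)
  leibniz_lie x y b := Prod.ext (add_zero _).symm (by
    change ⁅x, ⁅y, b.2⁆ - weightDerivation R b.1 y⁆ - weightDerivation R 0 x =
      ⁅⁅x, y⁆, b.2⁆ - weightDerivation R b.1 ⁅x, y⁆ +
        (⁅y, ⁅x, b.2⁆ - weightDerivation R b.1 x⁆ - weightDerivation R 0 y)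
    rw [weightDerivation_zero, LieDerivation.zero_apply, LieDerivation.zero_apply, LieDerivation.apply_lie_eq_sub,
      lie_sub, lie_sub, leibniz_lie x y]
    abel)

instance : LieModule ℂ (SerreAlgebra A) (Borel R) where
  smul_lie c x b := Prod.ext (smul_zero _).symm (by
    change ⁅c • x, b.2⁆ - weightDerivation R b.1 (c • x) =
      c • (⁅x, b.2⁆ - weightDerivation R b.1 x)
    rw [smul_lie, map_smul, smul_sub])
  lie_smul c x b := Prod.ext (smul_zero _).symm (by
    change ⁅x, c • b.2⁆ - weightDerivation R (c • b.1) x =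
      c • (⁅x, b.2⁆ - weightDerivation R b.1 x)
    rw [lie_smul, weightDerivation_smul, LieDerivation.smul_apply, smul_sub])

namespace Borel

variable {R}

/-- The element `h + x` of `𝔥 ⊕ N`. -/
def mk (R : CartanRealization A 𝔥) (h : 𝔥) (x : SerreAlgebra A) : Borel R := (h, x)

/-- The component in `𝔥`. -/
def cartan : Borel R →ₗ[ℂ] 𝔥 := LinearMap.fst ℂ 𝔥 (SerreAlgebra A)

/-- The component in `N`. -/
def nil : Borel R →ₗ[ℂ] SerreAlgebra A := LinearMap.snd ℂ 𝔥 (SerreAlgebra A)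

@[simp] theorem cartan_mk (h : 𝔥) (x : SerreAlgebra A) : cartan (mk R h x) = h := rfl

@[simp] theorem nil_mk (h : 𝔥) (x : SerreAlgebra A) : nil (mk R h x) = x := rfl

theorem ext {b c : Borel R} (h1 : cartan b = cartan c) (h2 : nil b = nil c) : b = c :=
  Prod.ext h1 h2

@[simp] theorem cartan_lie (x : SerreAlgebra A) (b : Borel R) : cartan ⁅x, b⁆ = 0 := rfl

@[simp] theorem nil_lie (x : SerreAlgebra A) (b : Borel R) :
    nil ⁅x, b⁆ = ⁅x, nil b⁆ - weightDerivation R (cartan b) x := rfl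

end Borel

end SerreAlgebra

end Serre

/-! ### Contractions: the action of f_k on the Serre algebra. -/

section Serre

variable {n : ℕ} {A : Matrix (Fin n) (Fin n) ℤ}
variable {𝔥 : Type u} [AddCommGroup 𝔥] [Module ℂ 𝔥] (R : CartanRealization A 𝔥)

namespace SerreAlgebra

theorem weightDerivation_ad_pow (h : 𝔥) (i j : Fin n) (m : ℕ) :
    weightDerivation R h (((LieAlgebra.ad ℂ _ (e A i)) ^ m) (e A j)) =
      (m * R.root i h + R.root j h) • ((LieAlgebra.ad ℂ _ (e A i)) ^ m) (e A j) := by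
  induction m with
  | zero => simp [weightDerivation_e]
  | succ m ih =>
    rw [pow_succ', Module.End.mul_apply, LieAlgebra.ad_apply, LieDerivation.apply_lie_eq_add, ih,
      weightDerivation_e, lie_smul, smul_lie, ← add_smul]
    congr 1
    push_cast
    ring

/-- The prescribed values are [f_k, e_i] = -δ_ik h_k, so this is what makes ad f_k descend to a
derivation N → 𝔥 ⊕ N. In the split extension the first component of a Serre element is zero by
definition of N. The second is treated by cases: k = i is the sl₂ recursion, k = j reduces to a_ji
(ad e_i)^m e_i, and otherwise nothing contributes. -/
theorem lift_contraction_serre (hA : IsGeneralizedCartanMatrix A) (k : Fin n) :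
    ∀ r ∈ {r | SerreRelation A r}, FreeLieAlgebra.lift ℂ
      (fun i => (⟨e A i, if i = k then Borel.mk R (-R.coroot k) 0 else 0⟩ :
        SplitExtension (SerreAlgebra A) (Borel R))) r = 0 := by
  refine lift_serre _ fun i j hij => ?_
  set x : SplitExtension (SerreAlgebra A) (Borel R) :=
    ⟨e A i, if i = k then Borel.mk R (-R.coroot k) 0 else 0⟩ with hx
  set y : SplitExtension (SerreAlgebra A) (Borel R) :=
    ⟨e A j, if j = k then Borel.mk R (-R.coroot k) 0 else 0⟩ with hy
  obtain ⟨m, hm⟩ : ∃ m : ℕ, A i j = -m :=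
    ⟨(-A i j).toNat, by have := hA.off_diag_nonpos i j hij; omega⟩
  have hr : (1 - A i j).toNat = m + 1 := by omega
  have hserre := ad_e_pow A hij
  rw [hr] at hserre ⊢
  refine SplitExtension.ext ((SplitExtension.fst_ad_pow x y _).trans hserre) ?_
  change (((LieAlgebra.ad ℂ _ x) ^ (m + 1)) y).snd = 0
  have hx1 : x.fst = e A i := rfl
  have hy1 : y.fst = e A j := rfl
  by_cases hik : i = k
  · subst hik
    have hjk : j ≠ i := hij.symm
    have hsnd := recursion_of_weights
      (LieModule.toEnd ℂ (SerreAlgebra A) (Borel R) (e A i)) (A i j)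
      (fun m => Borel.mk R 0 (((LieAlgebra.ad ℂ _ (e A i)) ^ m) (e A j)))
      (fun m => (((LieAlgebra.ad ℂ _ x) ^ m) y).snd) (fun m => ?_) ?_ (fun m => ?_) m
    · refine hsnd.trans ?_
      rw [hm]
      simp
    · rw [LieModule.toEnd_apply_apply]
      refine Borel.ext (by simp) ?_
      simp [pow_succ', weightDerivation_zero]
    · change y.snd = 0
      simp [hy, hjk]
    · have hx2 : x.snd = Borel.mk R (-R.coroot i) 0 := by simp [hx]
      simp only [SplitExtension.snd_ad_pow_succ, hx1, hx2, hy1, LieModule.toEnd_apply_apply]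
      congr 1
      refine Borel.ext (by simp) ?_
      simp [weightDerivation_neg, weightDerivation_ad_pow, R.root_coroot, hA.diag, mul_comm]
  · have hx2 : x.snd = 0 := by simp [hx, hik]
    have hsnd (m : ℕ) : (((LieAlgebra.ad ℂ _ x) ^ m) y).snd =
        ((LieModule.toEnd ℂ (SerreAlgebra A) (Borel R) (e A i)) ^ m) y.snd := by
      induction m with
      | zero => rfl
      | succ m ih =>
        rw [SplitExtension.snd_ad_pow_succ, hx2, lie_zero, sub_zero, ih, pow_succ']
        rfl
    rw [hsnd]
    by_cases hjk : j = k
    · subst hjk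
      have hE : ⁅e A i, y.snd⁆ = Borel.mk R 0 ((A j i : ℂ) • e A i) := by
        refine Borel.ext (by simp) ?_
        simp [hy, weightDerivation_neg, weightDerivation_e, R.root_coroot]
      rw [pow_succ, Module.End.mul_apply, LieModule.toEnd_apply_apply, hE]
      cases m with
      | zero =>
        rw [hA.zero_symm i j (by simpa using hm)]
        exact Borel.ext (by simp) (by simp)
      | succ m =>
        rw [pow_succ, Module.End.mul_apply, LieModule.toEnd_apply_apply]
        have : ⁅e A i, Borel.mk R 0 ((A j i : ℂ) • e A i)⁆ = 0 :=
          Borel.ext (by simp) (by simp [weightDerivation_zero])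
        rw [this, map_zero]
    · have : y.snd = 0 := by simp [hy, hjk]
      rw [this, map_zero]

/-- The contraction by `f_k`: the derivation of the Serre algebra that corresponds to `ad f_k`. -/
def contraction (hA : IsGeneralizedCartanMatrix A) (k : Fin n) :
    LieDerivation ℂ (SerreAlgebra A) (Borel R) :=
  PresentedLieAlgebra.derivation _ (lift_contraction_serre R hA k)

variable (hA : IsGeneralizedCartanMatrix A)

theorem contraction_e (k i : Fin n) :
    contraction R hA k (e A i) = if i = k then Borel.mk R (-R.coroot k) 0 else 0 :=
  PresentedLieAlgebra.derivation_of _ (lift_contraction_serre R hA k) i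

theorem cartan_contraction_lie (k : Fin n) (x y : SerreAlgebra A) :
    Borel.cartan (contraction R hA k ⁅x, y⁆) = 0 := by
  rw [LieDerivation.apply_lie_eq_sub, map_sub, Borel.cartan_lie, Borel.cartan_lie, sub_zero]

theorem nil_contraction_e (k i : Fin n) : Borel.nil (contraction R hA k (e A i)) = 0 := by
  rw [contraction_e]
  split_ifs <;> simp

/-- The Jacobi identity for [f_k, [e_i, x]]: the middle term is [e_i, h'] = -α_i(h') e_i for the
𝔥-component h' of [f_k, x], and the last one is [[f_k, e_i], x]. -/
theorem nil_contraction_e_lie (k i : Fin n) (x : SerreAlgebra A) :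
    Borel.nil (contraction R hA k ⁅e A i, x⁆) = ⁅e A i, Borel.nil (contraction R hA k x)⁆ -
      R.root i (Borel.cartan (contraction R hA k x)) • e A i -
        if i = k then weightDerivation R (R.coroot k) x else 0 := by
  rw [LieDerivation.apply_lie_eq_sub, map_sub, Borel.nil_lie, Borel.nil_lie, nil_contraction_e,
    weightDerivation_e, contraction_e]
  split_ifs
  · simp [weightDerivation_neg]
  · simp [weightDerivation_zero]

/-- In components, this is [f_k, [h, x]] = α_k(h) [f_k, x] + [h, [f_k, x]], where 𝔥 acts by zero on
its own component. -/
theorem contraction_weightDerivation (k : Fin n) (h : 𝔥) (x : SerreAlgebra A) :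
    Borel.cartan (contraction R hA k (weightDerivation R h x)) =
        R.root k h • Borel.cartan (contraction R hA k x) ∧
      Borel.nil (contraction R hA k (weightDerivation R h x)) =
        R.root k h • Borel.nil (contraction R hA k x) +
          weightDerivation R h (Borel.nil (contraction R hA k x)) := by
  induction x using SerreAlgebra.induction with
  | h0 => simp
  | he i =>
    simp only [weightDerivation_e, map_smul, contraction_e]
    split_ifs with hik
    · subst hik; simp
    · simp
  | hadd x y hx hy =>
    simp only [map_add, hx.1, hx.2, hy.1, hy.2, smul_add]
    exact ⟨trivial, by abel⟩
  | hsmul c x hx =>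
    simp only [map_smul, hx.1, hx.2, smul_add, smul_comm c]
    exact ⟨trivial, trivial⟩
  | hlie i x hx =>
    have hD : weightDerivation R h ⁅e A i, x⁆ =
        ⁅e A i, weightDerivation R h x⁆ + R.root i h • ⁅e A i, x⁆ := by
      rw [LieDerivation.apply_lie_eq_add, weightDerivation_e, smul_lie]
    rw [hD]
    simp only [map_add, map_smul, cartan_contraction_lie, smul_zero, add_zero, true_and,
      nil_contraction_e_lie, hx.1, hx.2, map_sub, weightDerivation_e,
      LieDerivation.apply_lie_eq_add, smul_lie, lie_add, lie_smul, smul_sub, smul_eq_mul]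
    by_cases hik : i = k
    · subst hik
      simp only [if_true, weightDerivation_comm R h]
      module
    · simp only [hik, if_false, smul_zero, map_zero]
      module

end SerreAlgebra

end Serre

section Serre

variable {n : ℕ} {A : Matrix (Fin n) (Fin n) ℤ}
variable {𝔥 : Type u} [AddCommGroup 𝔥] [Module ℂ 𝔥] (R : CartanRealization A 𝔥)
variable (hA : IsGeneralizedCartanMatrix A)

namespace SerreAlgebra

/-! ### The adjoint module of the Kac-Moody algebra, on `N ⊕ 𝔥 ⊕ N` -/

section TriangularModule

attribute [local instance] LieRing.ofAssociativeRing

/-- The action of `h ∈ 𝔥` on `N ⊕ 𝔥 ⊕ N`. -/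
def cartanOp (h : 𝔥) : Module.End ℂ (SerreAlgebra A × 𝔥 × SerreAlgebra A) where
  toFun v := (weightDerivation R h v.1, 0, -weightDerivation R h v.2.2)
  map_add' v w := by simp [add_comm]
  map_smul' c v := by simp

/-- The action of `eᵢ` on `N ⊕ 𝔥 ⊕ N`. -/
def raisingOp (i : Fin n) : Module.End ℂ (SerreAlgebra A × 𝔥 × SerreAlgebra A) where
  -- The triple (x, h, y) stands for x + h + ω(y). The formula is the bracket with e_i, using [e_i,
  -- ω(y)] = -ω([f_i, y]) and ω = -1 on 𝔥. In this model `flipEquiv` is ω, and f_i = -ω(e_i)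
  -- accounts for the form of `loweringOp`.
  toFun v := (⁅e A i, v.1⁆ - R.root i v.2.1 • e A i,
    Borel.cartan (contraction R hA i v.2.2), -Borel.nil (contraction R hA i v.2.2))
  map_add' v w := by
    simp only [Prod.fst_add, Prod.snd_add, map_add, lie_add, Prod.mk_add_mk, Prod.mk.injEq, true_and]
    exact ⟨by module, by module⟩
  map_smul' c v := by
    simp only [Prod.smul_fst, Prod.smul_snd, map_smul, lie_smul, Prod.smul_mk, Prod.mk.injEq,
      RingHom.id_apply, true_and, smul_eq_mul]
    exact ⟨by module, by module⟩

/-- The involution of `N ⊕ 𝔥 ⊕ N` that interchanges the outer summands. -/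
def flipEquiv (n : ℕ) (A : Matrix (Fin n) (Fin n) ℤ) (𝔥 : Type u) [AddCommGroup 𝔥] [Module ℂ 𝔥] :
    (SerreAlgebra A × 𝔥 × SerreAlgebra A) ≃ₗ[ℂ] (SerreAlgebra A × 𝔥 × SerreAlgebra A) where
  toFun v := (v.2.2, -v.2.1, v.1)
  invFun v := (v.2.2, -v.2.1, v.1)
  left_inv v := by simp
  right_inv v := by simp
  map_add' v w := by simp [add_comm]
  map_smul' c v := by simp

/-- The action of `fᵢ` on `N ⊕ 𝔥 ⊕ N`. -/
def loweringOp (i : Fin n) : Module.End ℂ (SerreAlgebra A × 𝔥 × SerreAlgebra A) :=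
  -(flipEquiv n A 𝔥).lieConj (raisingOp R hA i)

theorem cartanOp_apply (h : 𝔥) (v : SerreAlgebra A × 𝔥 × SerreAlgebra A) :
    cartanOp R h v = (weightDerivation R h v.1, 0, -weightDerivation R h v.2.2) := rfl

theorem raisingOp_apply (i : Fin n) (v : SerreAlgebra A × 𝔥 × SerreAlgebra A) :
    raisingOp R hA i v = (⁅e A i, v.1⁆ - R.root i v.2.1 • e A i,
      Borel.cartan (contraction R hA i v.2.2), -Borel.nil (contraction R hA i v.2.2)) := rfl

theorem loweringOp_apply (i : Fin n) (v : SerreAlgebra A × 𝔥 × SerreAlgebra A) :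
    loweringOp R hA i v = (Borel.nil (contraction R hA i v.1),
      Borel.cartan (contraction R hA i v.1), -⁅e A i, v.2.2⁆ - R.root i v.2.1 • e A i) := by
  change -(flipEquiv n A 𝔥) (raisingOp R hA i ((flipEquiv n A 𝔥).symm v)) = _
  change -((-Borel.nil (contraction R hA i v.1), -Borel.cartan (contraction R hA i v.1),
    ⁅e A i, v.2.2⁆ - R.root i (-v.2.1) • e A i) : SerreAlgebra A × 𝔥 × SerreAlgebra A) = _
  simp only [Prod.neg_mk, neg_neg, map_neg, neg_smul, Prod.mk.injEq, true_and]
  abel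

theorem lie_cartanOp_cartanOp (h k : 𝔥) : ⁅cartanOp R h, cartanOp R k⁆ = 0 := by
  refine LinearMap.ext fun v => ?_
  rw [Ring.lie_def, LinearMap.sub_apply, Module.End.mul_apply, Module.End.mul_apply]
  simp [cartanOp_apply, weightDerivation_comm R h k]

theorem lie_cartanOp_raisingOp (h : 𝔥) (i : Fin n) :
    ⁅cartanOp R h, raisingOp R hA i⁆ = R.root i h • raisingOp R hA i := by
  refine LinearMap.ext fun v => ?_
  rw [Ring.lie_def, LinearMap.sub_apply, Module.End.mul_apply, Module.End.mul_apply,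
    LinearMap.smul_apply]
  simp only [cartanOp_apply, raisingOp_apply, map_sub, map_neg, map_smul, map_zero,
    (contraction_weightDerivation R hA i h _).1, (contraction_weightDerivation R hA i h _).2,
    weightDerivation_e, LieDerivation.apply_lie_eq_add, smul_lie, Prod.mk_sub_mk, Prod.smul_mk,
    Prod.mk.injEq]
  exact ⟨by module, by module, by module⟩

theorem lieConj_cartanOp (h : 𝔥) :
    (flipEquiv n A 𝔥).lieConj (cartanOp R h) = -cartanOp R h := by
  refine LinearMap.ext fun v => ?_
  change (flipEquiv n A 𝔥) (cartanOp R h ((flipEquiv n A 𝔥).symm v)) = _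
  change ((-weightDerivation R h v.1, -0, weightDerivation R h v.2.2) :
    SerreAlgebra A × 𝔥 × SerreAlgebra A) = -cartanOp R h v
  simp [cartanOp_apply]

theorem lie_cartanOp_loweringOp (h : 𝔥) (i : Fin n) :
    ⁅cartanOp R h, loweringOp R hA i⁆ = -(R.root i h • loweringOp R hA i) := by
  have := congrArg (flipEquiv n A 𝔥).lieConj (lie_cartanOp_raisingOp R hA h i)
  rw [LieEquiv.map_lie, lieConj_cartanOp, map_smul] at this
  rw [loweringOp, lie_neg, ← neg_lie, this, smul_neg, neg_neg]

theorem lie_raisingOp_loweringOp (i j : Fin n) :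
    ⁅raisingOp R hA i, loweringOp R hA j⁆ = if i = j then cartanOp R (R.coroot i) else 0 := by
  refine LinearMap.ext fun v => ?_
  rw [Ring.lie_def, LinearMap.sub_apply, Module.End.mul_apply, Module.End.mul_apply]
  simp only [raisingOp_apply, loweringOp_apply, map_sub, map_neg, map_smul, nil_contraction_e_lie,
    cartan_contraction_lie, contraction_e]
  by_cases hij : i = j
  · subst hij
    simp only [if_true, cartanOp_apply, Prod.mk_sub_mk, Prod.mk.injEq, Borel.cartan_mk, Borel.nil_mk,
      lie_neg]
    exact ⟨by module, by module, by module⟩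
  · simp only [hij, Ne.symm hij, if_false, map_zero, Prod.mk_sub_mk, LinearMap.zero_apply, lie_neg]
    refine Prod.ext ?_ (Prod.ext ?_ ?_)
    · simp only [Prod.fst_zero]; module
    · simp only [Prod.fst_zero, Prod.snd_zero]; module
    · simp only [Prod.snd_zero]; module

/-- On N ⊕ 𝔥 ⊕ 0 the raising operators act as N acts on 𝔥 ⋉ N, so their action there factors through
N. This yields the Serre relations on that subspace and, at (0, ρ, 0), the injectivity of N → 𝔤(A).
-/
theorem lift_raisingOp_apply (u : FreeLieAlgebra ℂ (Fin n)) (x : SerreAlgebra A) (h : 𝔥) :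
    FreeLieAlgebra.lift ℂ (raisingOp R hA) u (x, h, 0) =
      (⁅PresentedLieAlgebra.mk {r | SerreRelation A r} u, x⁆ -
        weightDerivation R h (PresentedLieAlgebra.mk {r | SerreRelation A r} u), 0, 0) := by
  have hu : u ∈ LieSubalgebra.lieSpan ℂ _ (Set.range (FreeLieAlgebra.of ℂ (X := Fin n))) :=
    FreeLieAlgebra.lieSpan_range_of ▸ LieSubalgebra.mem_top u
  induction hu using LieSubalgebra.lieSpan_induction generalizing x h with
  | mem u hu =>
    obtain ⟨i, rfl⟩ := hu
    rw [FreeLieAlgebra.lift_of_apply, raisingOp_apply]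
    change _ = (⁅e A i, x⁆ - weightDerivation R h (e A i), (0 : 𝔥), (0 : SerreAlgebra A))
    rw [weightDerivation_e]
    simp
  | zero => simp only [map_zero, LinearMap.zero_apply, zero_lie, sub_zero]; rfl
  | add u w _ _ hu hw =>
    simp only [map_add, LinearMap.add_apply, hu, hw, add_lie, Prod.mk_add_mk, add_zero]
    congr 1
    abel
  | smul c u _ hu =>
    simp only [map_smul, LinearMap.smul_apply, hu, smul_lie, Prod.smul_mk, smul_zero, smul_sub]
  | lie u w _ _ hu hw =>
    rw [LieHom.map_lie, Ring.lie_def, LinearMap.sub_apply, Module.End.mul_apply,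
      Module.End.mul_apply, hu, hw, hu, hw]
    simp only [LieHom.map_lie, weightDerivation_zero, LieDerivation.zero_apply, Prod.mk_sub_mk,
      sub_zero, lie_sub, LieDerivation.apply_lie_eq_sub, lie_lie]
    congr 1
    abel

/-- The Serre element T of the raising operators kills N ⊕ 𝔥 ⊕ 0, where the action factors through
N. It commutes with all lowering operators, and these generate the last summand from (0, ρ, 0), so T
kills everything. -/
theorem ad_raisingOp_pow {ρ : 𝔥} (hρ : ∀ i, R.root i ρ = 1) {i j : Fin n} (hij : i ≠ j) :
    ((LieAlgebra.ad ℂ _ (raisingOp R hA i)) ^ (1 - A i j).toNat) (raisingOp R hA j) = 0 := by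
  set T := ((LieAlgebra.ad ℂ _ (raisingOp R hA i)) ^ (1 - A i j).toNat) (raisingOp R hA j) with hT
  have hcomm (k : Fin n) (v) : T (loweringOp R hA k v) = loweringOp R hA k (T v) := by
    have h : ⁅loweringOp R hA k, T⁆ = 0 :=
      lie_serre_eq_zero (h := fun i => cartanOp R (R.coroot i))
        (fun i j => by rw [lie_cartanOp_raisingOp, R.root_coroot])
        (lie_raisingOp_loweringOp R hA) hA.diag hA.off_diag_nonpos hA.zero_symm hij k
    have := LinearMap.congr_fun h v
    rw [Ring.lie_def, LinearMap.sub_apply, Module.End.mul_apply, Module.End.mul_apply,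
      LinearMap.zero_apply, sub_eq_zero] at this
    exact this.symm
  have hupper (x : SerreAlgebra A) (h : 𝔥) : T (x, h, 0) = 0 := by
    have := lift_raisingOp_apply R hA (((LieAlgebra.ad ℂ _ (FreeLieAlgebra.of ℂ i)) ^
      (1 - A i j).toNat) (FreeLieAlgebra.of ℂ j)) x h
    rw [PresentedLieAlgebra.mk_eq_zero (rels := {r | SerreRelation A r}) (.serre i j hij),
      KacMoodyAlgebra.map_ad_pow, FreeLieAlgebra.lift_of_apply, FreeLieAlgebra.lift_of_apply,
      ← hT] at this
    rw [this, zero_lie, map_zero, sub_zero]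
    rfl
  have hlower (y : SerreAlgebra A) : T (0, 0, y) = 0 := by
    induction y using SerreAlgebra.induction with
    | h0 => exact map_zero T
    | he k =>
      -- Since α_k(ρ) = 1, lowering ρ produces exactly the generator of the last summand, up to
      -- sign.
      have : ((0, 0, e A k) : SerreAlgebra A × 𝔥 × SerreAlgebra A) =
          -loweringOp R hA k (0, ρ, 0) := by simp [loweringOp_apply, hρ]
      rw [this, map_neg, hcomm, hupper, map_zero, neg_zero]
    | hadd x y hx hy =>
      have : ((0, 0, x + y) : SerreAlgebra A × 𝔥 × SerreAlgebra A) = (0, 0, x) + (0, 0, y) := by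
        simp
      rw [this, map_add, hx, hy, add_zero]
    | hsmul c x hx =>
      have : ((0, 0, c • x) : SerreAlgebra A × 𝔥 × SerreAlgebra A) = c • (0, 0, x) := by simp
      rw [this, map_smul, hx, smul_zero]
    | hlie k x hx =>
      have : ((0, 0, ⁅e A k, x⁆) : SerreAlgebra A × 𝔥 × SerreAlgebra A) =
          -loweringOp R hA k (0, 0, x) := by simp [loweringOp_apply]
      rw [this, map_neg, hcomm, hx, map_zero, neg_zero]
  refine LinearMap.ext fun ⟨x, h, y⟩ => ?_
  have : (x, h, y) = (x, h, 0) + ((0, 0, y) : SerreAlgebra A × 𝔥 × SerreAlgebra A) := by simp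
  rw [this, map_add, hupper, hlower, add_zero]
  rfl

theorem ad_loweringOp_pow {ρ : 𝔥} (hρ : ∀ i, R.root i ρ = 1) {i j : Fin n} (hij : i ≠ j) :
    ((LieAlgebra.ad ℂ _ (loweringOp R hA i)) ^ (1 - A i j).toNat) (loweringOp R hA j) = 0 := by
  refine KacMoodyAlgebra.ad_neg_pow _ _ _ ?_
  have := congrArg (flipEquiv n A 𝔥).lieConj (ad_raisingOp_pow R hA hρ hij)
  rwa [map_zero, ← LieEquiv.coe_toLieHom, KacMoodyAlgebra.map_ad_pow] at this

/-- The operators by which the generators of the Kac-Moody algebra act on `N ⊕ 𝔥 ⊕ N`. -/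
def generatorOp :
    KacMoodyGenerator n 𝔥 → Module.End ℂ (SerreAlgebra A × 𝔥 × SerreAlgebra A)
  | .h x => cartanOp R x
  | .e i => raisingOp R hA i
  | .f i => loweringOp R hA i

theorem generatorOp_relation {ρ : 𝔥} (hρ : ∀ i, R.root i ρ = 1) :
    ∀ r ∈ {r | KacMoodyRelation R r}, FreeLieAlgebra.lift ℂ (generatorOp R hA) r = 0 := by
  intro r hr
  set σ := FreeLieAlgebra.lift ℂ (generatorOp R hA)
  have hH (x : 𝔥) : σ (KacMoodyGenerator.H n x) = cartanOp R x := FreeLieAlgebra.lift_of_apply ..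
  have hE (i : Fin n) : σ (KacMoodyGenerator.E 𝔥 i) = raisingOp R hA i :=
    FreeLieAlgebra.lift_of_apply ..
  have hF (i : Fin n) : σ (KacMoodyGenerator.F 𝔥 i) = loweringOp R hA i :=
    FreeLieAlgebra.lift_of_apply ..
  cases hr with
  | add x y =>
    simp only [map_sub, map_add, hH]
    refine LinearMap.ext fun v => ?_
    simp [cartanOp_apply, weightDerivation_add, add_comm]
  | smul c x =>
    simp only [map_sub, map_smul, hH]
    refine LinearMap.ext fun v => ?_
    simp [cartanOp_apply, weightDerivation_smul]
  | h_h x y => rw [LieHom.map_lie, hH, hH, lie_cartanOp_cartanOp]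
  | h_e x j => rw [map_sub, LieHom.map_lie, map_smul, hH, hE, lie_cartanOp_raisingOp, sub_self]
  | h_f x j =>
    rw [map_add, LieHom.map_lie, map_smul, hH, hF, lie_cartanOp_loweringOp, neg_add_cancel]
  | e_f_same i =>
    rw [map_sub, LieHom.map_lie, hE, hF, hH, lie_raisingOp_loweringOp, if_pos rfl, sub_self]
  | e_f_ne i j hij => rw [LieHom.map_lie, hE, hF, lie_raisingOp_loweringOp, if_neg hij]
  | serre_e i j hij => rw [KacMoodyAlgebra.map_ad_pow, hE, hE, ad_raisingOp_pow R hA hρ hij]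
  | serre_f i j hij => rw [KacMoodyAlgebra.map_ad_pow, hF, hF, ad_loweringOp_pow R hA hρ hij]

end TriangularModule

/-! ### The embedding of the Serre algebra into the Kac–Moody algebra. -/

theorem kacMoody_serre_e {i j : Fin n} (hij : i ≠ j) :
    ((LieAlgebra.ad ℂ _ (KacMoodyAlgebra.e R i)) ^ (1 - A i j).toNat) (KacMoodyAlgebra.e R j) =
      0 := by
  have := PresentedLieAlgebra.mk_eq_zero (rels := {r | KacMoodyRelation R r}) (.serre_e i j hij)
  rwa [KacMoodyAlgebra.map_ad_pow] at this

/-- The homomorphism from the Serre algebra to the Kac-Moody algebra. -/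
def toKacMoody : SerreAlgebra A →ₗ⁅ℂ⁆ KacMoodyAlgebra R :=
  PresentedLieAlgebra.lift (KacMoodyAlgebra.e R) (lift_serre _ fun _ _ => kacMoody_serre_e R)

theorem toKacMoody_e (i : Fin n) : toKacMoody R (e A i) = KacMoodyAlgebra.e R i :=
  PresentedLieAlgebra.lift_of ..

theorem weightDerivation_nestedBracket {ρ : 𝔥} (hρ : ∀ i, R.root i ρ = 1) (i : Fin n)
    (l : List (Fin n)) :
    weightDerivation R ρ (nestedBracket (e A) i l) =
      ((l.length + 1 : ℕ) : ℂ) • nestedBracket (e A) i l := by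
  induction l generalizing i with
  | nil => simp [nestedBracket, weightDerivation_e, hρ]
  | cons k l ih =>
    rw [nestedBracket, LieDerivation.apply_lie_eq_add, ih, weightDerivation_e, hρ, one_smul,
      lie_smul, List.length_cons]
    push_cast
    module

theorem lieSpan_range_e : LieSubalgebra.lieSpan ℂ _ (Set.range (e A)) = ⊤ :=
  PresentedLieAlgebra.lieSpan_range_of

/-- The derivation has eigenvalue m on brackets of m generators, and these span. A kernel element
therefore lies in the span of brackets of length 0, which is zero. -/
theorem weightDerivation_injective {ρ : 𝔥} (hρ : ∀ i, R.root i ρ = 1) {x : SerreAlgebra A}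
    (hx : weightDerivation R ρ x = 0) : x = 0 := by
  let T : Module.End ℂ (SerreAlgebra A) := (weightDerivation R ρ).toLinearMap
  have hS (m : ℕ) : exactBracketSpan (e A) m ≤ T.eigenspace (m : ℂ) := by
    refine Submodule.span_le.2 ?_
    rintro _ ⟨i, l, rfl, rfl⟩
    exact Module.End.mem_eigenspace_iff.2 (weightDerivation_nestedBracket R hρ i l)
  obtain ⟨j, hj⟩ := exists_mem_bracketSpan (b := e A)
    (lieSpan_range_e (A := A) ▸ LieSubalgebra.mem_top x)
  have h0 : x ∈ T.eigenspace ((0 : ℕ) : ℂ) := Module.End.mem_eigenspace_iff.2 (by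
    rw [Nat.cast_zero, zero_smul]; exact hx)
  have := exactBracketSpan_le 0
    (mem_of_mem_eigenspace_of_mem_iSup T _ hS h0 (bracketSpan_le_iSup j hj))
  rwa [bracketSpan_zero, Submodule.mem_bot] at this

attribute [local instance] LieRing.ofAssociativeRing in
-- If x dies in 𝔤(A) it acts by zero on N ⊕ 𝔥 ⊕ N. But it sends (0, ρ, 0) to (-ρ·x, 0, 0), and ρ
-- acts injectively on N.
theorem toKacMoody_injective (hA : IsGeneralizedCartanMatrix A) {ρ : 𝔥} (hρ : ∀ i, R.root i ρ = 1) :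
    Function.Injective (toKacMoody R) := by
  refine (injective_iff_map_eq_zero _).2 fun x hx => weightDerivation_injective R hρ ?_
  obtain ⟨u, rfl⟩ := PresentedLieAlgebra.mk_surjective x
  let σ := PresentedLieAlgebra.lift (generatorOp R hA) (generatorOp_relation R hA hρ)
  have hσ : σ.comp ((toKacMoody R).comp (PresentedLieAlgebra.mk {r | SerreRelation A r})) =
      FreeLieAlgebra.lift ℂ (raisingOp R hA) := FreeLieAlgebra.hom_ext fun i => by
    change σ (toKacMoody R (e A i)) = _
    rw [toKacMoody_e, FreeLieAlgebra.lift_of_apply]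
    exact PresentedLieAlgebra.lift_of ..
  have h1 := LinearMap.congr_fun (LieHom.congr_fun hσ u) (0, ρ, 0)
  rw [LieHom.comp_apply, LieHom.comp_apply, hx, map_zero, lift_raisingOp_apply, lie_zero,
    zero_sub] at h1
  exact neg_eq_zero.1 (congrArg Prod.fst h1).symm

end SerreAlgebra

/-- Linear independence of the simple roots gives a functional on the dual of 𝔥 that takes the value
1 on each of them. By finite-dimensionality it is evaluation at some ρ. -/
theorem CartanRealization.exists_height : ∃ ρ : 𝔥, ∀ i, R.root i ρ = 1 := by
  have := R.finiteDimensional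
  obtain ⟨g, hg⟩ := LinearMap.exists_leftInverse_of_injective
    (Finsupp.linearCombination ℂ R.root) (LinearMap.ker_eq_bot.2 R.linearIndependent_root)
  let F : Module.Dual ℂ (Module.Dual ℂ 𝔥) :=
    (Finsupp.linearCombination ℂ fun _ : Fin n => (1 : ℂ)).comp g
  refine ⟨(Module.evalEquiv ℂ 𝔥).symm F, fun i => ?_⟩
  rw [Module.apply_evalEquiv_symm_apply]
  have h1 : g (R.root i) = Finsupp.single i 1 := by
    have := LinearMap.congr_fun hg (Finsupp.single i 1)
    simpa using this
  simp [F, h1]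

end Serre

/-! ### The inhomogeneous Serre relations -/

section OnsagerCoeff

variable (a : ℤ)

theorem onsagerCoeff_of_lt (r : ℕ) : ∀ s, r < s → onsagerCoeff a r s = 0 := by
  induction r using Nat.strong_induction_on with
  | _ r ih =>
    intro s hs
    match r, s with
    | 0, s + 1 => rw [onsagerCoeff]
    | 1, s + 2 => rw [onsagerCoeff]
    | r + 2, s + 1 => rw [onsagerCoeff, ih (r + 1) (by omega) s (by omega),
        ih r (by omega) (s + 1) (by omega), mul_zero, sub_zero]

theorem onsagerCoeff_self (r : ℕ) : onsagerCoeff a r r = 1 := by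
  induction r with
  | zero => rw [onsagerCoeff]
  | succ r ih =>
    match r with
    | 0 => rw [onsagerCoeff]
    | r + 1 => rw [onsagerCoeff, ih, onsagerCoeff_of_lt a r _ (by omega), mul_zero, sub_zero]

variable {V : Type*} [AddCommGroup V] [Module ℂ V] (T : Module.End ℂ V) (v : V)

/-- The value `∑ₛ c_s[r] Tˢ v` of an Onsager polynomial. -/
def onsagerSum (r : ℕ) : V :=
  ∑ s ∈ Finset.range (r + 1), (onsagerCoeff a r s : ℂ) • (T ^ s) v

theorem onsagerSum_zero : onsagerSum a T v 0 = v := by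
  simp [onsagerSum, onsagerCoeff]

theorem onsagerSum_one : onsagerSum a T v 1 = T v := by
  simp [onsagerSum, onsagerCoeff, Finset.sum_range_succ]

/-- The recursion of the coefficients, rewritten as P_{r+2} = T P_{r+1} - (r+1)(r+a) P_r for the
Onsager polynomials applied to `v`. -/
theorem onsagerSum_add_two (r : ℕ) :
    onsagerSum a T v (r + 2) =
      T (onsagerSum a T v (r + 1)) - ((r + 1) * (r + a) : ℂ) • onsagerSum a T v r := by
  -- Two vanishing top terms are added so that all three sums can be compared index by index.
  have h1 : onsagerSum a T v r =
      ∑ s ∈ Finset.range (r + 2 + 1), (onsagerCoeff a r s : ℂ) • (T ^ s) v := by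
    rw [Finset.sum_range_succ, Finset.sum_range_succ, onsagerCoeff_of_lt a r _ (by omega),
      onsagerCoeff_of_lt a r _ (by omega)]
    simp [onsagerSum]
  rw [h1, onsagerSum, onsagerSum, Finset.sum_range_succ', Finset.sum_range_succ' _ (r + 2),
    map_sum, smul_add, Finset.smul_sum, ← sub_sub, ← Finset.sum_sub_distrib]
  have h2 (s : ℕ) : (onsagerCoeff a (r + 2) (s + 1) : ℂ) • (T ^ (s + 1)) v =
      T ((onsagerCoeff a (r + 1) s : ℂ) • (T ^ s) v) -
        ((r + 1) * (r + a) : ℂ) • (onsagerCoeff a r (s + 1) : ℂ) • (T ^ (s + 1)) v := by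
    rw [onsagerCoeff, map_smul, ← Module.End.mul_apply, ← pow_succ', smul_smul, ← sub_smul]
    push_cast
    rfl
  rw [Finset.sum_congr rfl fun s _ => h2 s, onsagerCoeff, smul_smul, sub_eq_add_neg, ← neg_smul]
  congr 2
  push_cast
  ring

end OnsagerCoeff

/-! ### Kac–Moody relations and Onsager polynomials in ad Y_i. -/

section KacMoody

variable {n : ℕ} {A : Matrix (Fin n) (Fin n) ℤ}
variable {𝔥 : Type u} [AddCommGroup 𝔥] [Module ℂ 𝔥] (R : CartanRealization A 𝔥)

namespace KacMoodyAlgebra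

theorem h_add (x y : 𝔥) : h R (x + y) = h R x + h R y := by
  have := PresentedLieAlgebra.mk_eq_zero (rels := {r | KacMoodyRelation R r}) (.add x y)
  rw [map_sub, map_add, sub_eq_zero] at this
  exact this

theorem h_smul (c : ℂ) (x : 𝔥) : h R (c • x) = c • h R x := by
  have := PresentedLieAlgebra.mk_eq_zero (rels := {r | KacMoodyRelation R r}) (.smul c x)
  rw [map_sub, map_smul, sub_eq_zero] at this
  exact this

theorem lie_h_h (x y : 𝔥) : ⁅h R x, h R y⁆ = 0 := by
  have := PresentedLieAlgebra.mk_eq_zero (rels := {r | KacMoodyRelation R r}) (.h_h x y)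
  rw [LieHom.map_lie] at this
  exact this

theorem lie_h_e (x : 𝔥) (i : Fin n) : ⁅h R x, e R i⁆ = R.root i x • e R i := by
  have := PresentedLieAlgebra.mk_eq_zero (rels := {r | KacMoodyRelation R r}) (.h_e x i)
  rw [map_sub, LieHom.map_lie, map_smul, sub_eq_zero] at this
  exact this

theorem lie_h_f (x : 𝔥) (i : Fin n) : ⁅h R x, f R i⁆ = -(R.root i x • f R i) := by
  have := PresentedLieAlgebra.mk_eq_zero (rels := {r | KacMoodyRelation R r}) (.h_f x i)
  rw [map_add, LieHom.map_lie, map_smul, add_eq_zero_iff_eq_neg] at this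
  exact this

theorem lie_e_f (i j : Fin n) : ⁅e R i, f R j⁆ = if i = j then h R (R.coroot i) else 0 := by
  split_ifs with hij
  · subst hij
    have := PresentedLieAlgebra.mk_eq_zero (rels := {r | KacMoodyRelation R r}) (.e_f_same i)
    rw [map_sub, LieHom.map_lie, sub_eq_zero] at this
    exact this
  · have := PresentedLieAlgebra.mk_eq_zero (rels := {r | KacMoodyRelation R r}) (.e_f_ne i j hij)
    rw [LieHom.map_lie] at this
    exact this

theorem mem_fixedPoints {x : KacMoodyAlgebra R} : x ∈ fixedPoints R ↔ chevalleyHom R x = x :=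
  Iff.rfl

theorem chevalleyHom_chevalleyHom (x : KacMoodyAlgebra R) :
    chevalleyHom R (chevalleyHom R x) = x :=
  LieHom.congr_fun (chevalleyHom_comp_self R) x

/-- The elements `Yᵢ = eᵢ - fᵢ`. -/
def Y (i : Fin n) : KacMoodyAlgebra R := e R i - f R i

theorem Y_mem_fixedPoints (i : Fin n) : Y R i ∈ fixedPoints R := by
  rw [mem_fixedPoints, Y, map_sub, chevalleyHom_e, chevalleyHom_f]
  abel

/-- Put z_r = (ad e_i)^r e_j and s_r = z_r + ω(z_r). As Y_i is fixed by ω, [Y_i, s_{r+1}] is the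
symmetrization of [e_i, z_{r+1}] - [f_i, z_{r+1}], which is s_{r+2} + (r+1)(r+a_ij) s_r by the sl₂
computation. This is the recursion of the Onsager polynomials, and the initial values agree. -/
theorem onsagerSum_Y (hA : IsGeneralizedCartanMatrix A) {i j : Fin n} (hij : i ≠ j) (r : ℕ) :
    onsagerSum (A i j) (LieAlgebra.ad ℂ _ (Y R i)) (Y R j) r =
      ((LieAlgebra.ad ℂ _ (e R i)) ^ r) (e R j) +
        chevalleyHom R (((LieAlgebra.ad ℂ _ (e R i)) ^ r) (e R j)) := by
  have hadd (z : KacMoodyAlgebra R) : ⁅Y R i, z + chevalleyHom R z⁆ =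
      (⁅e R i, z⁆ - ⁅f R i, z⁆) + chevalleyHom R (⁅e R i, z⁆ - ⁅f R i, z⁆) := by
    rw [Y, map_sub, LieHom.map_lie, LieHom.map_lie, chevalleyHom_e, chevalleyHom_f, lie_add,
      sub_lie, sub_lie, neg_lie, neg_lie]
    abel
  induction r using Nat.strong_induction_on with
  | _ r ih =>
    match r with
    | 0 => rw [onsagerSum_zero, pow_zero, Module.End.one_apply, chevalleyHom_e, Y, sub_eq_add_neg]
    | 1 =>
      have hY : Y R j = e R j + chevalleyHom R (e R j) := by
        rw [chevalleyHom_e, Y, sub_eq_add_neg]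
      have hfe : ⁅f R i, e R j⁆ = 0 := by
        rw [← lie_skew, lie_e_f, if_neg hij.symm, neg_zero]
      rw [onsagerSum_one, LieAlgebra.ad_apply, hY, hadd, hfe, sub_zero, pow_one,
        LieAlgebra.ad_apply]
    | r + 2 =>
      have hf := lie_ad_pow_same (L := KacMoodyAlgebra R) (h := fun i => h R (R.coroot i))
        (fun i j => by rw [lie_h_e, R.root_coroot]) (lie_e_f R) hA.diag hij r
      rw [onsagerSum_add_two, ih (r + 1) (by omega), ih r (by omega), LieAlgebra.ad_apply, hadd,
        hf, pow_succ' _ (r + 1), Module.End.mul_apply, LieAlgebra.ad_apply]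
      simp only [neg_smul, sub_neg_eq_add, map_add, map_smul, smul_add]
      abel

end KacMoodyAlgebra

end KacMoody

section KacMoody

variable {n : ℕ} {A : Matrix (Fin n) (Fin n) ℤ}
variable {𝔥 : Type u} [AddCommGroup 𝔥] [Module ℂ 𝔥] (R : CartanRealization A 𝔥)

namespace KacMoodyAlgebra

/-! ### The homomorphism from the Onsager algebra to the fixed points -/

theorem onsager_relation_Y (hA : IsGeneralizedCartanMatrix A) :
    ∀ r ∈ {r | OnsagerRelation A r}, FreeLieAlgebra.lift ℂ
      (fun i => (⟨Y R i, Y_mem_fixedPoints R i⟩ : fixedPoints R)) r = 0 := by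
  rintro _ ⟨i, j, hij⟩
  refine (fixedPoints R).toSubmodule.injective_subtype ?_
  change (fixedPoints R).incl (FreeLieAlgebra.lift ℂ _ _) = 0
  simp only [map_sum, map_smul, map_ad_pow, FreeLieAlgebra.lift_of_apply]
  refine (onsagerSum_Y R hA hij _).trans ?_
  rw [SerreAlgebra.kacMoody_serre_e R hij, map_zero, add_zero]

/-- The homomorphism `Bᵢ ↦ Yᵢ`. -/
def fromOnsager (hA : IsGeneralizedCartanMatrix A) :
    OnsagerAlgebra A →ₗ⁅ℂ⁆ fixedPoints R :=
  PresentedLieAlgebra.lift _ (onsager_relation_Y R hA)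

theorem fromOnsager_B (hA : IsGeneralizedCartanMatrix A) (i : Fin n) :
    (fromOnsager R hA (OnsagerAlgebra.B A i) : KacMoodyAlgebra R) = Y R i :=
  congrArg Subtype.val (PresentedLieAlgebra.lift_of _ (onsager_relation_Y R hA) i)

theorem fromOnsager_nestedBracket (hA : IsGeneralizedCartanMatrix A) (i : Fin n)
    (l : List (Fin n)) :
    (fromOnsager R hA (nestedBracket (OnsagerAlgebra.B A) i l) : KacMoodyAlgebra R) =
      nestedBracket (Y R) i l := by
  have := map_nestedBracket (b := OnsagerAlgebra.B A)
    ((fixedPoints R).incl.comp (fromOnsager R hA)) i l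
  rwa [show ((fixedPoints R).incl.comp (fromOnsager R hA)) ∘ OnsagerAlgebra.B A = Y R from
    funext (fromOnsager_B R hA)] at this

/-! ### Weights of nested brackets -/

theorem nestedBracket_mem_rootSpace (i : Fin n) (l : List (Fin n)) :
    nestedBracket (e R) i l ∈ rootSpace R (((i :: l).map R.root).sum) := by
  induction l generalizing i with
  | nil => intro y; simpa [nestedBracket] using lie_h_e R y i
  | cons k l ih =>
    intro y
    rw [nestedBracket, leibniz_lie, lie_h_e, ih k y, lie_smul, smul_lie, ← add_smul]
    simp

theorem posWeight_count (l : List (Fin n)) :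
    posWeight R (fun k => l.count k) = (l.map R.root).sum := by
  induction l with
  | nil => simp [posWeight]
  | cons i l ih =>
    rw [List.map_cons, List.sum_cons, ← ih]
    simp [posWeight, List.count_cons, add_smul, Finset.sum_add_distrib, add_comm]

theorem sum_count (l : List (Fin n)) : ∑ k, l.count k = l.length := by
  induction l with
  | nil => simp
  | cons i l ih => simp [List.count_cons, Finset.sum_add_distrib, ih]

theorem lie_h_mem_bracketSpan (x : 𝔥) {m : ℕ} {z : KacMoodyAlgebra R}
    (hz : z ∈ bracketSpan (e R) m) : ⁅h R x, z⁆ ∈ bracketSpan (e R) m := by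
  induction hz using Submodule.span_induction with
  | mem z hz =>
    obtain ⟨i, l, hl, rfl⟩ := hz
    rw [nestedBracket_mem_rootSpace R i l x]
    exact Submodule.smul_mem _ _ (Submodule.subset_span ⟨i, l, hl, rfl⟩)
  | zero => simp
  | add y z _ _ hy hz => rw [lie_add]; exact add_mem hy hz
  | smul c y _ hy => rw [lie_smul]; exact Submodule.smul_mem _ c hy

/-- The image of `𝔥` in the Kac-Moody algebra. -/
def cartanPart : Submodule ℂ (KacMoodyAlgebra R) :=
  LinearMap.range ({ toFun := h R, map_add' := h_add R, map_smul' := h_smul R } :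
    𝔥 →ₗ[ℂ] KacMoodyAlgebra R)

theorem lie_e_mem_bracketSpan (i : Fin n) {m : ℕ} {z : KacMoodyAlgebra R}
    (hz : z ∈ cartanPart R ⊔ bracketSpan (e R) m) : ⁅e R i, z⁆ ∈ bracketSpan (e R) (m + 1) := by
  obtain ⟨_, ⟨x, rfl⟩, w, hw, rfl⟩ := Submodule.mem_sup.1 hz
  rw [lie_add]
  refine add_mem ?_ (gen_lie_mem_bracketSpan _ i hw)
  change ⁅e R i, h R x⁆ ∈ _
  rw [← lie_skew, lie_h_e]
  exact neg_mem (Submodule.smul_mem _ _ (gen_mem_bracketSpan _ i (by omega)))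

/-- The bracket has length `l.length + 1`: applying f_k shortens it by one, or leaves an element of
𝔥 when the length was one. -/
theorem lie_f_nestedBracket (k i : Fin n) (l : List (Fin n)) :
    ⁅f R k, nestedBracket (e R) i l⁆ ∈ cartanPart R ⊔ bracketSpan (e R) l.length := by
  have hfe (i : Fin n) : ∃ x, ⁅f R k, e R i⁆ = h R x := by
    rw [← lie_skew, lie_e_f]
    split_ifs
    · exact ⟨-R.coroot i, by rw [← neg_one_smul ℂ, ← neg_one_smul ℂ (R.coroot i), h_smul]⟩
    · exact ⟨0, by rw [neg_zero, ← zero_smul ℂ (0 : 𝔥), h_smul, zero_smul]⟩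
  induction l generalizing i with
  | nil =>
    obtain ⟨x, hx⟩ := hfe i
    exact Submodule.mem_sup_left ⟨x, hx.symm⟩
  | cons j l ih =>
    obtain ⟨x, hx⟩ := hfe i
    rw [nestedBracket, leibniz_lie, hx]
    exact Submodule.mem_sup_right (add_mem
      (lie_h_mem_bracketSpan R x (Submodule.subset_span ⟨j, l, le_rfl, rfl⟩))
      (lie_e_mem_bracketSpan R i (ih j)))

theorem lie_f_mem (k : Fin n) {m : ℕ} {z : KacMoodyAlgebra R} (hz : z ∈ bracketSpan (e R) m) :
    ⁅f R k, z⁆ ∈ cartanPart R ⊔ bracketSpan (e R) m := by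
  induction hz using Submodule.span_induction with
  | mem z hz =>
    obtain ⟨i, l, hl, rfl⟩ := hz
    have : bracketSpan (e R) l.length ≤ bracketSpan (e R) m := bracketSpan_mono _ (by omega)
    exact SetLike.le_def.1 (sup_le_sup_left this _) (lie_f_nestedBracket R k i l)
  | zero => simp
  | add y z _ _ hy hz => rw [lie_add]; exact add_mem hy hz
  | smul c y _ hy => rw [lie_smul]; exact Submodule.smul_mem _ c hy

/-! ### The triangular decomposition -/

theorem chevalleyHom_mem_cartanPart {z : KacMoodyAlgebra R} (hz : z ∈ cartanPart R) :
    chevalleyHom R z = -z := by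
  obtain ⟨x, rfl⟩ := hz
  exact chevalleyHom_h R x

/-- The sum of `𝔥`, `𝔫` and the opposite of `𝔫`. -/
def triangularSum : Submodule ℂ (KacMoodyAlgebra R) :=
  cartanPart R ⊔ ((nilpotentPart R).toSubmodule ⊔
    (nilpotentPart R).toSubmodule.map (chevalleyHom R).toLinearMap)

theorem mem_triangularSum {z : KacMoodyAlgebra R} : z ∈ triangularSum R ↔
    ∃ x ∈ cartanPart R, ∃ y ∈ nilpotentPart R, ∃ y' ∈ nilpotentPart R,
      z = x + (y + chevalleyHom R y') := by
  constructor
  · intro hz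
    obtain ⟨x, hx, _, hw, rfl⟩ := Submodule.mem_sup.1 hz
    obtain ⟨y, hy, _, ⟨y', hy', rfl⟩, rfl⟩ := Submodule.mem_sup.1 hw
    exact ⟨x, hx, y, hy, y', hy', rfl⟩
  · rintro ⟨x, hx, y, hy, y', hy', rfl⟩
    exact add_mem (Submodule.mem_sup_left hx) (Submodule.mem_sup_right
      (add_mem (Submodule.mem_sup_left hy) (Submodule.mem_sup_right ⟨y', hy', rfl⟩)))

theorem chevalleyHom_mem_triangularSum {z : KacMoodyAlgebra R} (hz : z ∈ triangularSum R) :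
    chevalleyHom R z ∈ triangularSum R := by
  rw [mem_triangularSum] at hz ⊢
  obtain ⟨x, hx, y, hy, y', hy', rfl⟩ := hz
  refine ⟨-x, neg_mem hx, y', hy', y, hy, ?_⟩
  rw [map_add, map_add, chevalleyHom_chevalleyHom, chevalleyHom_mem_cartanPart R hx, add_comm y']

theorem e_mem_nilpotentPart (i : Fin n) : e R i ∈ nilpotentPart R :=
  LieSubalgebra.subset_lieSpan ⟨i, rfl⟩

theorem lie_f_mem_of_nilpotentPart (k : Fin n) {z : KacMoodyAlgebra R}
    (hz : z ∈ nilpotentPart R) :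
    ∃ x ∈ cartanPart R, ∃ y ∈ nilpotentPart R, ⁅f R k, z⁆ = x + y := by
  obtain ⟨m, hm⟩ := exists_mem_bracketSpan hz
  obtain ⟨x, hx, y, hy, hxy⟩ := Submodule.mem_sup.1 (lie_f_mem R k hm)
  exact ⟨x, hx, y, bracketSpan_le_lieSpan m hy, hxy.symm⟩

theorem lie_h_mem_nilpotentPart (x : 𝔥) {z : KacMoodyAlgebra R} (hz : z ∈ nilpotentPart R) :
    ⁅h R x, z⁆ ∈ nilpotentPart R := by
  obtain ⟨m, hm⟩ := exists_mem_bracketSpan hz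
  exact bracketSpan_le_lieSpan m (lie_h_mem_bracketSpan R x hm)

theorem lie_e_mem_triangularSum (i : Fin n) {z : KacMoodyAlgebra R} (hz : z ∈ triangularSum R) :
    ⁅e R i, z⁆ ∈ triangularSum R := by
  rw [mem_triangularSum] at hz ⊢
  obtain ⟨_, ⟨x, rfl⟩, y, hy, y', hy', rfl⟩ := hz
  obtain ⟨a, ha, b, hb, hab⟩ := lie_f_mem_of_nilpotentPart R i hy'
  refine ⟨a, ha, -(R.root i x • e R i) + ⁅e R i, y⁆, add_mem (neg_mem (SMulMemClass.smul_mem _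
    (e_mem_nilpotentPart R i))) (LieSubalgebra.lie_mem _ (e_mem_nilpotentPart R i) hy),
    -b, neg_mem hb, ?_⟩
  have h1 : ⁅e R i, chevalleyHom R y'⁆ = a - chevalleyHom R b := by
    have : e R i = -chevalleyHom R (f R i) := by rw [chevalleyHom_f, neg_neg]
    rw [this, neg_lie, ← LieHom.map_lie, hab, map_add, chevalleyHom_mem_cartanPart R ha]
    abel
  change ⁅e R i, h R x + (y + chevalleyHom R y')⁆ = _
  rw [lie_add, lie_add, h1, ← lie_skew, lie_h_e, map_neg]
  abel

/-- The sum contains the generators, so stability under them suffices. The sum is ω-stable and f_i =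
-ω(e_i), so the case of f_i follows from that of e_i. -/
theorem triangularSum_eq_top : triangularSum R = ⊤ := by
  have hn {z} (hz : z ∈ nilpotentPart R) : z ∈ triangularSum R :=
    Submodule.mem_sup_right (Submodule.mem_sup_left hz)
  have hf (i : Fin n) : f R i = -chevalleyHom R (e R i) := by rw [chevalleyHom_e, neg_neg]
  refine eq_top_of_lie_stable PresentedLieAlgebra.lieSpan_range_of _ ?_ ?_
  · rintro _ ⟨x | i | i, rfl⟩
    · exact Submodule.mem_sup_left ⟨x, rfl⟩
    · exact hn (e_mem_nilpotentPart R i)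
    · change f R i ∈ _
      rw [hf]
      exact neg_mem (chevalleyHom_mem_triangularSum R (hn (e_mem_nilpotentPart R i)))
  · rintro _ ⟨x | i | i, rfl⟩ z hz
    · change ⁅h R x, z⁆ ∈ _
      rw [mem_triangularSum] at hz
      obtain ⟨_, ⟨x', rfl⟩, y, hy, y', hy', rfl⟩ := hz
      change ⁅h R x, h R x' + (y + chevalleyHom R y')⁆ ∈ _
      have h1 : ⁅h R x, chevalleyHom R y'⁆ = -chevalleyHom R ⁅h R x, y'⁆ := by
        rw [LieHom.map_lie, chevalleyHom_h, neg_lie, neg_neg]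
      rw [lie_add, lie_add, lie_h_h, zero_add, h1]
      exact add_mem (hn (lie_h_mem_nilpotentPart R x hy))
        (neg_mem (chevalleyHom_mem_triangularSum R (hn (lie_h_mem_nilpotentPart R x hy'))))
    · exact lie_e_mem_triangularSum R i hz
    · change ⁅f R i, z⁆ ∈ _
      have : ⁅f R i, z⁆ = -chevalleyHom R ⁅e R i, chevalleyHom R z⁆ := by
        rw [hf, LieHom.map_lie, chevalleyHom_chevalleyHom, neg_lie]
      rw [this]
      exact neg_mem (chevalleyHom_mem_triangularSum R
        (lie_e_mem_triangularSum R i (chevalleyHom_mem_triangularSum R hz)))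

/-! ### Surjectivity onto the fixed points -/

theorem Y_lie_add_chevalleyHom (i : Fin n) (z : KacMoodyAlgebra R) :
    ⁅Y R i, z + chevalleyHom R z⁆ =
      (⁅e R i, z⁆ + chevalleyHom R ⁅e R i, z⁆) - (⁅f R i, z⁆ + chevalleyHom R ⁅f R i, z⁆) := by
  rw [Y, LieHom.map_lie, LieHom.map_lie, chevalleyHom_e, chevalleyHom_f, lie_add,
    sub_lie, sub_lie, neg_lie, neg_lie]
  abel

/-- The linear endomorphism `z ↦ z + ω z`. -/
def symmetrization : KacMoodyAlgebra R →ₗ[ℂ] KacMoodyAlgebra R :=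
  LinearMap.id + (chevalleyHom R).toLinearMap

theorem symmetrization_apply (z : KacMoodyAlgebra R) :
    symmetrization R z = z + chevalleyHom R z := rfl

/-- Induction on length through sym[e_i, z] = [Y_i, sym z] + sym[f_i, z]. The element [f_i, z] is no
longer than z up to a part in 𝔥, and symmetrization kills 𝔥 because ω = -1 there. -/
theorem symmetrization_mem_range (hA : IsGeneralizedCartanMatrix A) (m : ℕ) :
    ∀ z ∈ bracketSpan (e R) m, symmetrization R z ∈
      ((fixedPoints R).incl.comp (fromOnsager R hA)).range := by
  set K := ((fixedPoints R).incl.comp (fromOnsager R hA)).range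
  have hY (i : Fin n) : Y R i ∈ K := ⟨OnsagerAlgebra.B A i, fromOnsager_B R hA i⟩
  induction m with
  | zero =>
    intro z hz
    rw [bracketSpan_zero, Submodule.mem_bot] at hz
    rw [hz, map_zero]
    exact zero_mem K
  | succ m ih =>
    suffices bracketSpan (e R) (m + 1) ≤ K.toSubmodule.comap (symmetrization R) from this
    refine Submodule.span_le.2 ?_
    rintro _ ⟨i, _ | ⟨k, l⟩, hl, rfl⟩
    · change e R i + chevalleyHom R (e R i) ∈ K
      rw [chevalleyHom_e, ← sub_eq_add_neg]
      exact hY i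
    · set z := nestedBracket (e R) k l
      have hz : z ∈ bracketSpan (e R) m := Submodule.subset_span ⟨k, l, by simpa using hl, rfl⟩
      have h1 : symmetrization R ⁅e R i, z⁆ =
          ⁅Y R i, symmetrization R z⁆ + symmetrization R ⁅f R i, z⁆ := by
        simp only [symmetrization_apply, Y_lie_add_chevalleyHom, sub_add_cancel]
      change symmetrization R ⁅e R i, z⁆ ∈ K
      rw [h1]
      refine add_mem (K.lie_mem (hY i) (ih z hz)) ?_
      obtain ⟨x, hx, y, hy, hxy⟩ := Submodule.mem_sup.1 (lie_f_mem R i hz)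
      rw [← hxy, map_add, symmetrization_apply, chevalleyHom_mem_cartanPart R hx, add_neg_cancel,
        zero_add]
      exact ih y hy

/-- A fixed point is x = (x + ω(x))/2. Inserting the triangular decomposition of x cancels the part
in 𝔥 and leaves symmetrizations of elements of 𝔫. -/
theorem fromOnsager_surjective (hA : IsGeneralizedCartanMatrix A) :
    Function.Surjective (fromOnsager R hA) := by
  intro ⟨x, hx⟩
  suffices x ∈ ((fixedPoints R).incl.comp (fromOnsager R hA)).range by
    obtain ⟨y, hy⟩ := this
    exact ⟨y, Subtype.ext hy⟩
  have hsymm {z} (hz : z ∈ nilpotentPart R) : symmetrization R z ∈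
      ((fixedPoints R).incl.comp (fromOnsager R hA)).range := by
    obtain ⟨m, hm⟩ := exists_mem_bracketSpan hz
    exact symmetrization_mem_range R hA m z hm
  have hx' : x ∈ triangularSum R := triangularSum_eq_top R ▸ Submodule.mem_top
  obtain ⟨a, ha, y, hy, y', hy', hxy⟩ := (mem_triangularSum R).1 hx'
  have h2 : x = (2⁻¹ : ℂ) • (symmetrization R y + symmetrization R y') := by
    have : (2 : ℂ) • x = symmetrization R y + symmetrization R y' := by
      rw [two_smul]
      nth_rewrite 2 [← (mem_fixedPoints R).1 hx]
      rw [hxy, symmetrization_apply, symmetrization_apply, map_add, map_add,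
        chevalleyHom_chevalleyHom, chevalleyHom_mem_cartanPart R ha]
      abel
    rw [← this, smul_smul]
    norm_num
  rw [h2]
  exact SMulMemClass.smul_mem _ (add_mem (hsymm hy) (hsymm hy'))

/-! ### The grading by heights -/

section Height

variable {R} {ρ : 𝔥}

/-- The adjoint action of `ρ ∈ 𝔥`. -/
def heightOp (R : CartanRealization A 𝔥) (ρ : 𝔥) : Module.End ℂ (KacMoodyAlgebra R) :=
  LieAlgebra.ad ℂ _ (h R ρ)

theorem mem_eigenspace_heightOp {c : ℂ} {z : KacMoodyAlgebra R} :
    z ∈ (heightOp R ρ).eigenspace c ↔ ⁅h R ρ, z⁆ = c • z :=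
  Module.End.mem_eigenspace_iff

theorem rootSpace_posWeight_le (hρ : ∀ i, R.root i ρ = 1) (r : Fin n → ℕ) :
    rootSpace R (posWeight R r) ≤ (heightOp R ρ).eigenspace ((∑ i, r i : ℕ) : ℂ) := by
  intro z hz
  rw [mem_eigenspace_heightOp, hz ρ]
  congr 1
  simp [posWeight, hρ]

theorem exactBracketSpan_e_le (hρ : ∀ i, R.root i ρ = 1) (m : ℕ) :
    exactBracketSpan (e R) m ≤ (heightOp R ρ).eigenspace (m : ℂ) := by
  refine Submodule.span_le.2 ?_
  rintro _ ⟨i, l, rfl, rfl⟩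
  have h1 := nestedBracket_mem_rootSpace R i l
  rw [← posWeight_count] at h1
  have h2 := rootSpace_posWeight_le hρ _ h1
  rwa [sum_count] at h2

theorem lie_e_mem_lowerEigenspaces (hρ : ∀ i, R.root i ρ = 1) (i : Fin n) {j : ℤ}
    {z : KacMoodyAlgebra R} (hz : z ∈ lowerEigenspaces (heightOp R ρ) j) :
    ⁅e R i, z⁆ ∈ lowerEigenspaces (heightOp R ρ) (j + 1) := by
  refine map_mem_lowerEigenspaces (E := LieAlgebra.ad ℂ _ (e R i)) (fun m x hx => ?_) hz
  rw [mem_eigenspace_heightOp] at hx ⊢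
  rw [LieAlgebra.ad_apply, leibniz_lie, hx, lie_h_e, hρ]
  push_cast
  rw [lie_smul, one_smul]
  module

theorem lie_f_mem_lowerEigenspaces (hρ : ∀ i, R.root i ρ = 1) (i : Fin n) {j : ℤ}
    {z : KacMoodyAlgebra R} (hz : z ∈ lowerEigenspaces (heightOp R ρ) (j + 1)) :
    ⁅f R i, z⁆ ∈ lowerEigenspaces (heightOp R ρ) j := by
  have := map_mem_lowerEigenspaces (E := LieAlgebra.ad ℂ _ (f R i)) (d := -1)
    (fun m x hx => ?_) hz
  · rwa [add_neg_cancel_right] at this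
  rw [mem_eigenspace_heightOp] at hx ⊢
  rw [LieAlgebra.ad_apply, leibniz_lie, hx, lie_h_f, hρ]
  push_cast
  rw [lie_smul, neg_lie, smul_lie]
  module

theorem nestedBracket_e_mem (hρ : ∀ i, R.root i ρ = 1) (i : Fin n) (l : List (Fin n)) {j : ℤ}
    (hj : (l.length : ℤ) + 1 < j) :
    nestedBracket (e R) i l ∈ lowerEigenspaces (heightOp R ρ) j := by
  have := exactBracketSpan_e_le hρ (l.length + 1) (Submodule.subset_span ⟨i, l, rfl, rfl⟩)
  exact eigenspace_le_lowerEigenspaces hj (by push_cast at this ⊢; exact this)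

/-- Each Y_i = e_i - f_i raises the height by at most one, and only through e_i. So choosing e_i in
every slot gives the only term of top height `l.length + 1`. -/
theorem nestedBracket_Y_sub_mem (hρ : ∀ i, R.root i ρ = 1) (i : Fin n) (l : List (Fin n)) :
    nestedBracket (Y R) i l - nestedBracket (e R) i l ∈
      lowerEigenspaces (heightOp R ρ) (l.length + 1) := by
  induction l generalizing i with
  | nil =>
    have : f R i ∈ (heightOp R ρ).eigenspace ((-1 : ℤ) : ℂ) := by
      rw [mem_eigenspace_heightOp, lie_h_f, hρ]
      push_cast
      module
    have := neg_mem (eigenspace_le_lowerEigenspaces (by simp : (-1 : ℤ) < 0 + 1) this)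
    simpa [nestedBracket, Y] using this
  | cons k l ih =>
    set a := nestedBracket (Y R) k l with ha
    set b := nestedBracket (e R) k l with hb
    -- Heights below `l.length + 2` would already hold. The bound is relaxed by one so that
    -- `lie_f_mem_lowerEigenspaces` lands exactly on the target.
    have hY : a ∈ lowerEigenspaces (heightOp R ρ) ((l.length : ℤ) + 1 + 1 + 1) := by
      rw [← sub_add_cancel a b]
      exact add_mem (lowerEigenspaces_mono (by omega) (ih k))
        (nestedBracket_e_mem hρ k l (by omega))
    have h1 : nestedBracket (Y R) i (k :: l) - nestedBracket (e R) i (k :: l) =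
        ⁅e R i, a - b⁆ - ⁅f R i, a⁆ := by
      simp only [nestedBracket, ← ha, ← hb, lie_sub]
      rw [Y, sub_lie]
      abel
    rw [h1, List.length_cons]
    push_cast
    exact sub_mem (lie_e_mem_lowerEigenspaces hρ i (ih k)) (lie_f_mem_lowerEigenspaces hρ i hY)

end Height

end KacMoodyAlgebra

end KacMoody

/-! ### Homogeneous components of the associated graded algebra. -/

namespace LieFiltration.Gr

variable {L : Type u} [LieRing L] [LieAlgebra ℂ L] (F : LieFiltration L)

theorem incl_injective (j : ℕ+) : Function.Injective (incl F j) :=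
  DirectSum.of_injective (β := F.Piece) j

theorem cls_eq_zero_iff {j : ℕ+} {x : L} (hx : x ∈ F.space j) :
    cls F j x hx = 0 ↔ x ∈ F.space ((j : ℕ) - 1) := by
  rw [cls, map_eq_zero_iff _ (incl_injective F j), Submodule.Quotient.mk_eq_zero]
  rfl

theorem cls_smul {j : ℕ+} {x : L} (c : ℂ) (hx : x ∈ F.space j) :
    cls F j (c • x) (Submodule.smul_mem _ c hx) = c • cls F j x hx :=
  map_smul ((incl F j).comp ((F.space ((j : ℕ) - 1)).submoduleOf (F.space j)).mkQ) c ⟨x, hx⟩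

theorem cls_mem_component {j : ℕ+} {x : L} (hx : x ∈ F.space j) : cls F j x hx ∈ component F j :=
  ⟨_, rfl⟩

/-- The projection to the homogeneous component of degree `j`. -/
def proj (j : ℕ+) : F.Gr →ₗ[ℂ] F.Piece j := DirectSum.component ℂ ℕ+ F.Piece j

theorem proj_incl_self (j : ℕ+) (x : F.Piece j) : proj F j (incl F j x) = x :=
  DirectSum.component.lof_self ℂ j x

theorem proj_incl_of_ne {i j : ℕ+} (h : i ≠ j) (x : F.Piece i) : proj F j (incl F i x) = 0 :=
  DFinsupp.single_eq_of_ne (Ne.symm h)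

end LieFiltration.Gr

section Onsager

open LieFiltration

variable {n : ℕ} {A : Matrix (Fin n) (Fin n) ℤ}

namespace SerreAlgebra

/-! ### The homomorphism to the associated graded algebra -/

/-- The class of the generator `Bᵢ` in degree one. -/
def grB (A : Matrix (Fin n) (Fin n) ℤ) (i : Fin n) : (OnsagerAlgebra.filtration A).Gr :=
  Gr.cls (OnsagerAlgebra.filtration A) 1 (OnsagerAlgebra.B A i) (OnsagerAlgebra.B_mem_filtration A i)

theorem ad_B_pow_mem (i j : Fin n) (m : ℕ) :
    ((LieAlgebra.ad ℂ _ (OnsagerAlgebra.B A i)) ^ m) (OnsagerAlgebra.B A j) ∈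
      (OnsagerAlgebra.filtration A).space (m.succPNat : ℕ) := by
  induction m with
  | zero => exact OnsagerAlgebra.B_mem_filtration A j
  | succ m ih =>
    rw [pow_succ']
    exact gen_lie_mem_bracketSpan _ i ih

theorem ad_grB_pow (i j : Fin n) (m : ℕ) :
    ((LieAlgebra.ad ℂ _ (grB A i)) ^ m) (grB A j) =
      Gr.cls (OnsagerAlgebra.filtration A) m.succPNat
        (((LieAlgebra.ad ℂ _ (OnsagerAlgebra.B A i)) ^ m) (OnsagerAlgebra.B A j))
        (ad_B_pow_mem i j m) := by
  induction m with
  | zero => rfl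
  | succ m ih =>
    rw [pow_succ', Module.End.mul_apply, ih, LieAlgebra.ad_apply, grB, Gr.lie_cls]
    refine Gr.cls_congr _ (PNat.eq ?_) ?_ _ _
    · simp [add_comm]
    · rw [pow_succ']; rfl

/-- The top coefficient of the Onsager relation is 1, so (ad B_i)^r B_j, of nominal degree r + 1, is
a combination of lower powers and lies in filtration step r. Its class in degree r + 1 vanishes. -/
theorem ad_grB_serre {i j : Fin n} (hij : i ≠ j) :
    ((LieAlgebra.ad ℂ _ (grB A i)) ^ (1 - A i j).toNat) (grB A j) = 0 := by
  rw [ad_grB_pow, Gr.cls_eq_zero_iff]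
  set r := (1 - A i j).toNat
  have h := PresentedLieAlgebra.mk_eq_zero (rels := {r | OnsagerRelation A r}) (.serre i j hij)
  simp only [map_sum, map_smul, KacMoodyAlgebra.map_ad_pow] at h
  change ∑ s ∈ Finset.range (r + 1), (onsagerCoeff (A i j) r s : ℂ) •
    ((LieAlgebra.ad ℂ _ (OnsagerAlgebra.B A i)) ^ s) (OnsagerAlgebra.B A j) = 0 at h
  rw [Finset.sum_range_succ, onsagerCoeff_self, Int.cast_one, one_smul, add_comm,
    add_eq_zero_iff_eq_neg] at h
  rw [h]
  refine neg_mem (Submodule.sum_mem _ fun s hs => Submodule.smul_mem _ _ ?_)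
  have hs' : s + 1 ≤ r := Finset.mem_range.1 hs
  exact (OnsagerAlgebra.filtration A).mono hs' (ad_B_pow_mem i j s)

/-- The homomorphism `eᵢ ↦ [Bᵢ]₁`. -/
def toGr (A : Matrix (Fin n) (Fin n) ℤ) : SerreAlgebra A →ₗ⁅ℂ⁆ (OnsagerAlgebra.filtration A).Gr :=
  PresentedLieAlgebra.lift (grB A) (lift_serre _ fun _ _ => ad_grB_serre)

theorem toGr_e (i : Fin n) : toGr A (e A i) = grB A i := PresentedLieAlgebra.lift_of ..

theorem nestedBracket_B_mem (i : Fin n) (l : List (Fin n)) :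
    nestedBracket (OnsagerAlgebra.B A) i l ∈
      (OnsagerAlgebra.filtration A).space (l.length.succPNat : ℕ) :=
  Submodule.subset_span ⟨i, l, by simp, rfl⟩

theorem toGr_nestedBracket (i : Fin n) (l : List (Fin n)) :
    toGr A (nestedBracket (e A) i l) =
      Gr.cls (OnsagerAlgebra.filtration A) l.length.succPNat
        (nestedBracket (OnsagerAlgebra.B A) i l) (nestedBracket_B_mem i l) := by
  induction l generalizing i with
  | nil => exact toGr_e i
  | cons k l ih =>
    rw [nestedBracket, LieHom.map_lie, ih, toGr_e, grB, Gr.lie_cls]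
    exact Gr.cls_congr _ (PNat.eq (by simp [add_comm])) rfl _ _

/-- The span of the pairs of nested brackets of length `j` in the Serre algebra and in the Onsager
algebra. -/
def pairSpan (A : Matrix (Fin n) (Fin n) ℤ) (j : ℕ) :
    Submodule ℂ (SerreAlgebra A × OnsagerAlgebra A) :=
  Submodule.span ℂ {p | ∃ (i : Fin n) (l : List (Fin n)), l.length + 1 = j ∧
    p = (nestedBracket (e A) i l, nestedBracket (OnsagerAlgebra.B A) i l)}

/-- A linear dependence among brackets of the e_i need not hold for the B_i, so replacing e_i by B_i
is not a map on the span. Pairs of matching combinations take its place, and any element on either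
side can be completed to a pair. -/
theorem exists_pairSpan_of_serre {j : ℕ} {u : SerreAlgebra A}
    (hu : u ∈ exactBracketSpan (e A) j) : ∃ x, (u, x) ∈ pairSpan A j := by
  have : exactBracketSpan (e A) j ≤ (pairSpan A j).map (LinearMap.fst ℂ _ _) := by
    refine Submodule.span_le.2 ?_
    rintro _ ⟨i, l, hl, rfl⟩
    exact ⟨_, Submodule.subset_span ⟨i, l, hl, rfl⟩, rfl⟩
  obtain ⟨⟨_, x⟩, hx, rfl⟩ := this hu
  exact ⟨x, hx⟩

theorem exists_pairSpan_of_onsager {j : ℕ} {x : OnsagerAlgebra A}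
    (hx : x ∈ exactBracketSpan (OnsagerAlgebra.B A) j) : ∃ u, (u, x) ∈ pairSpan A j := by
  have : exactBracketSpan (OnsagerAlgebra.B A) j ≤ (pairSpan A j).map (LinearMap.snd ℂ _ _) := by
    refine Submodule.span_le.2 ?_
    rintro _ ⟨i, l, hl, rfl⟩
    exact ⟨_, Submodule.subset_span ⟨i, l, hl, rfl⟩, rfl⟩
  obtain ⟨⟨u, _⟩, hu, rfl⟩ := this hx
  exact ⟨u, hu⟩

theorem fst_mem_of_pairSpan {j : ℕ} {p : SerreAlgebra A × OnsagerAlgebra A}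
    (hp : p ∈ pairSpan A j) : p.1 ∈ exactBracketSpan (e A) j := by
  have : pairSpan A j ≤ (exactBracketSpan (e A) j).comap (LinearMap.fst ℂ _ _) := by
    refine Submodule.span_le.2 ?_
    rintro _ ⟨i, l, hl, rfl⟩
    exact Submodule.subset_span ⟨i, l, hl, rfl⟩
  exact this hp

theorem toGr_of_pairSpan {j : ℕ+} {p : SerreAlgebra A × OnsagerAlgebra A}
    (hp : p ∈ pairSpan A j) : ∃ hx : p.2 ∈ (OnsagerAlgebra.filtration A).space j,
      toGr A p.1 = Gr.cls (OnsagerAlgebra.filtration A) j p.2 hx := by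
  induction hp using Submodule.span_induction with
  | mem p hp =>
    obtain ⟨i, l, hl, rfl⟩ := hp
    have hj : l.length.succPNat = j := PNat.eq hl
    subst hj
    exact ⟨_, toGr_nestedBracket i l⟩
  | zero => exact ⟨zero_mem _, by
      rw [Prod.fst_zero, map_zero, eq_comm]; exact (Gr.cls_eq_zero_iff _ _).2 (zero_mem _)⟩
  | add p q _ _ hp hq =>
    obtain ⟨h1, hp⟩ := hp
    obtain ⟨h2, hq⟩ := hq
    exact ⟨add_mem h1 h2, by rw [Prod.fst_add, map_add, hp, hq, ← Gr.cls_add]; rfl⟩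
  | smul c p _ hp =>
    obtain ⟨h1, hp⟩ := hp
    exact ⟨Submodule.smul_mem _ c h1, by rw [Prod.smul_fst, map_smul, hp, ← Gr.cls_smul]; rfl⟩

theorem bracketSpan_B_succ {j : ℕ+} {x : OnsagerAlgebra A}
    (hx : x ∈ (OnsagerAlgebra.filtration A).space j) :
    ∃ u y, (u, y) ∈ pairSpan A j ∧ ∃ z ∈ (OnsagerAlgebra.filtration A).space ((j : ℕ) - 1),
      x = y + z := by
  obtain ⟨k, rfl⟩ : ∃ k : ℕ, j = k.succPNat := ⟨j.natPred, by simp⟩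
  obtain ⟨y, hy, z, hz, rfl⟩ := Submodule.mem_sup.1 (bracketSpan_succ_le k hx)
  obtain ⟨u, hu⟩ := exists_pairSpan_of_onsager hy
  exact ⟨u, y, hu, z, hz, rfl⟩

/-- Modulo shorter brackets an element of filtration step j is a combination of brackets of length
j, and the matching combination in N has the same class. -/
theorem component_le_map_toGr (j : ℕ+) : Gr.component (OnsagerAlgebra.filtration A) j ≤
    (exactBracketSpan (e A) j).map (toGr A).toLinearMap := by
  rintro _ ⟨q, rfl⟩
  obtain ⟨⟨x, hx⟩, rfl⟩ := Submodule.Quotient.mk_surjective _ q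
  change Gr.cls _ j x hx ∈ _
  obtain ⟨u, y, hu, z, hz, rfl⟩ := bracketSpan_B_succ hx
  obtain ⟨hy, h⟩ := toGr_of_pairSpan hu
  refine ⟨u, fst_mem_of_pairSpan hu, h.trans ?_⟩
  have hz' : z ∈ (OnsagerAlgebra.filtration A).space j :=
    (OnsagerAlgebra.filtration A).mono (by omega) hz
  rw [Gr.cls_add _ hy hz', (Gr.cls_eq_zero_iff _ hz').2 hz, add_zero]

theorem map_toGr_exactBracketSpan (j : ℕ+) :
    (exactBracketSpan (e A) j).map (toGr A).toLinearMap =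
      Gr.component (OnsagerAlgebra.filtration A) j := by
  refine le_antisymm ?_ (component_le_map_toGr j)
  rintro _ ⟨u, hu, rfl⟩
  obtain ⟨x, hx⟩ := exists_pairSpan_of_serre hu
  obtain ⟨hy, h⟩ := toGr_of_pairSpan hx
  change toGr A u ∈ _
  rw [h]
  exact Gr.cls_mem_component _ hy

theorem toGr_surjective : Function.Surjective (toGr A) := by
  intro x
  induction x using Gr.induction with
  | h0 => exact ⟨0, map_zero _⟩
  | hadd x y hx hy =>
    obtain ⟨u, rfl⟩ := hx
    obtain ⟨v, rfl⟩ := hy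
    exact ⟨u + v, map_add ..⟩
  | hcls j x hx =>
    obtain ⟨u, -, hu⟩ := component_le_map_toGr j (Gr.cls_mem_component _ hx)
    exact ⟨u, hu⟩

theorem proj_toGr_of_lt {j : ℕ+} {k : ℕ} (hk : k < j) {u : SerreAlgebra A}
    (hu : u ∈ bracketSpan (e A) k) :
    Gr.proj (OnsagerAlgebra.filtration A) j (toGr A u) = 0 := by
  suffices bracketSpan (e A) k ≤ LinearMap.ker
      ((Gr.proj (OnsagerAlgebra.filtration A) j).comp (toGr A).toLinearMap) from this hu
  refine Submodule.span_le.2 ?_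
  rintro _ ⟨i, l, hl, rfl⟩
  change Gr.proj _ j (toGr A _) = 0
  rw [toGr_nestedBracket]
  refine Gr.proj_incl_of_ne _ (fun h => ?_) _
  have := congrArg PNat.val h
  simp at this
  omega

/-! ### Comparison of the filtration with the grading of the Kac-Moody algebra -/

variable {𝔥 : Type u} [AddCommGroup 𝔥] [Module ℂ 𝔥] {R : CartanRealization A 𝔥} {ρ : 𝔥}

open KacMoodyAlgebra

theorem toKacMoody_nestedBracket (i : Fin n) (l : List (Fin n)) :
    toKacMoody R (nestedBracket (e A) i l) = nestedBracket (KacMoodyAlgebra.e R) i l := by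
  rw [map_nestedBracket]
  congr 1
  exact funext (toKacMoody_e R)

/-- The linear extension of `nestedBracket_Y_sub_mem`: the top-height part of ψ(x) is the image of
the partner of x in N. -/
theorem fromOnsager_sub_mem (hA : IsGeneralizedCartanMatrix A) (hρ : ∀ i, R.root i ρ = 1) {j : ℕ}
    {p : SerreAlgebra A × OnsagerAlgebra A} (hp : p ∈ pairSpan A j) :
    (fromOnsager R hA p.2 : KacMoodyAlgebra R) - toKacMoody R p.1 ∈
      lowerEigenspaces (heightOp R ρ) j := by
  induction hp using Submodule.span_induction with
  | mem p hp =>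
    obtain ⟨i, l, rfl, rfl⟩ := hp
    rw [fromOnsager_nestedBracket, toKacMoody_nestedBracket]
    exact_mod_cast nestedBracket_Y_sub_mem hρ i l
  | zero => simp
  | add p q _ _ hp hq =>
    rw [Prod.fst_add, Prod.snd_add, map_add, map_add, AddMemClass.coe_add, add_sub_add_comm]
    exact add_mem hp hq
  | smul c p _ hp =>
    rw [Prod.smul_fst, Prod.smul_snd, map_smul, map_smul, SetLike.val_smul, ← smul_sub]
    exact Submodule.smul_mem _ c hp

theorem fromOnsager_mem_lowerEigenspaces (hA : IsGeneralizedCartanMatrix A)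
    (hρ : ∀ i, R.root i ρ = 1) {m : ℕ} {j : ℤ} (hm : (m : ℤ) < j) {x : OnsagerAlgebra A}
    (hx : x ∈ (OnsagerAlgebra.filtration A).space m) :
    (fromOnsager R hA x : KacMoodyAlgebra R) ∈ lowerEigenspaces (heightOp R ρ) j := by
  suffices bracketSpan (OnsagerAlgebra.B A) m ≤ (lowerEigenspaces (heightOp R ρ) j).comap
      ((fixedPoints R).incl.comp (fromOnsager R hA)).toLinearMap from this hx
  refine Submodule.span_le.2 ?_
  rintro _ ⟨i, l, hl, rfl⟩
  change (fromOnsager R hA _ : KacMoodyAlgebra R) ∈ lowerEigenspaces (heightOp R ρ) j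
  rw [fromOnsager_nestedBracket, ← sub_add_cancel (nestedBracket _ i l)
    (nestedBracket (KacMoodyAlgebra.e R) i l)]
  have hle : (l.length : ℤ) + 1 ≤ j := by omega
  exact add_mem (lowerEigenspaces_mono hle (nestedBracket_Y_sub_mem hρ i l))
    (nestedBracket_e_mem hρ i l (by omega))

/-- The image of `u` in 𝔤(A) is homogeneous of height j. It is also a sum of terms of height below
j, as ψ(x) and their difference both are. So it vanishes, and N embeds in 𝔤(A). -/
theorem eq_zero_of_pairSpan (hA : IsGeneralizedCartanMatrix A) (hρ : ∀ i, R.root i ρ = 1) {j : ℕ}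
    {u : SerreAlgebra A} {x : OnsagerAlgebra A} (hux : (u, x) ∈ pairSpan A j)
    (hx : (fromOnsager R hA x : KacMoodyAlgebra R) ∈ lowerEigenspaces (heightOp R ρ) j) :
    u = 0 := by
  have h1 : toKacMoody R u ∈ lowerEigenspaces (heightOp R ρ) j := by
    have := sub_mem hx (fromOnsager_sub_mem hA hρ hux)
    rwa [sub_sub_cancel] at this
  have h2 : toKacMoody R u ∈ exactBracketSpan (KacMoodyAlgebra.e R) j := by
    have : toKacMoody R u ∈ (exactBracketSpan (e A) j).map (toKacMoody R).toLinearMap :=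
      ⟨u, fst_mem_of_pairSpan hux, rfl⟩
    rwa [map_exactBracketSpan, show toKacMoody R ∘ e A = KacMoodyAlgebra.e R from
      funext (toKacMoody_e R)] at this
  have h3 := eq_zero_of_mem_lowerEigenspaces (by
    rw [Int.cast_natCast]; exact exactBracketSpan_e_le hρ j h2) h1
  exact (injective_iff_map_eq_zero _).1 (toKacMoody_injective R hA hρ) u h3

/-- Induction on length, on the top-length part v of u. Its class in Gr is the top-degree part of
the image of u, hence zero; its partner then lies one filtration step lower, so ψ of that partner
has only smaller heights and v = 0. -/
theorem toGr_injective (R : CartanRealization A 𝔥) (hA : IsGeneralizedCartanMatrix A) :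
    Function.Injective (toGr A) := by
  obtain ⟨ρ, hρ⟩ := R.exists_height
  refine (injective_iff_map_eq_zero _).2 fun u hu => ?_
  obtain ⟨k, hk⟩ := exists_mem_bracketSpan (b := e A)
    (lieSpan_range_e (A := A) ▸ LieSubalgebra.mem_top u)
  induction k generalizing u with
  | zero => rwa [bracketSpan_zero, Submodule.mem_bot] at hk
  | succ k ih =>
    obtain ⟨v, hv, w, hw, rfl⟩ := Submodule.mem_sup.1 (bracketSpan_succ_le k hk)
    obtain ⟨x, hx⟩ := exists_pairSpan_of_serre hv
    obtain ⟨hx', h⟩ := toGr_of_pairSpan (j := k.succPNat) hx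
    have h1 : Gr.cls (OnsagerAlgebra.filtration A) k.succPNat x hx' = 0 := by
      have h2 := congrArg (Gr.proj (OnsagerAlgebra.filtration A) k.succPNat) hu
      rw [map_add, map_add, proj_toGr_of_lt (by simp) hw, add_zero, h, map_zero, Gr.cls,
        Gr.proj_incl_self] at h2
      rw [Gr.cls, h2, map_zero]
    have hv0 : v = 0 := eq_zero_of_pairSpan hA hρ hx
      (fromOnsager_mem_lowerEigenspaces hA hρ (by simp) ((Gr.cls_eq_zero_iff _ hx').1 h1))
    rw [hv0, zero_add] at hu ⊢
    exact ih w hu hw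

/-- Descent along the filtration: if ψ kills y + z with z in a lower step, the partner of the
leading part y vanishes in N. Hence y has zero class and belongs to the lower step too. -/
theorem fromOnsager_injective (hA : IsGeneralizedCartanMatrix A) :
    Function.Injective (fromOnsager R hA) := by
  obtain ⟨ρ, hρ⟩ := R.exists_height
  refine (injective_iff_map_eq_zero _).2 fun x hx => ?_
  obtain ⟨k, hk⟩ := (OnsagerAlgebra.filtration A).exhaustive x
  induction k with
  | zero => rwa [LieFiltration.space_zero, Submodule.mem_bot] at hk
  | succ k ih =>
    obtain ⟨u, y, hu, z, hz, rfl⟩ := bracketSpan_B_succ (j := k.succPNat) hk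
    obtain ⟨hy, h⟩ := toGr_of_pairSpan (j := k.succPNat) hu
    have hu0 : u = 0 := by
      refine eq_zero_of_pairSpan hA hρ hu ?_
      rw [map_add, add_eq_zero_iff_eq_neg] at hx
      rw [hx]
      exact neg_mem (fromOnsager_mem_lowerEigenspaces hA hρ (by simp) hz)
    rw [hu0, map_zero, eq_comm, Gr.cls_eq_zero_iff] at h
    exact ih (add_mem h hz)

/-! ### The nilpotent part -/

theorem serre_nilpotentPart_e {i j : Fin n} (hij : i ≠ j) :
    ((LieAlgebra.ad ℂ _ (nilpotentPart.e R i)) ^ (1 - A i j).toNat) (nilpotentPart.e R j) = 0 := by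
  refine (nilpotentPart R).toSubmodule.injective_subtype ?_
  change (nilpotentPart R).incl _ = 0
  rw [map_ad_pow]
  exact kacMoody_serre_e R hij

/-- The homomorphism from the Serre algebra onto the nilpotent part. -/
def toNilpotentPart (R : CartanRealization A 𝔥) : SerreAlgebra A →ₗ⁅ℂ⁆ nilpotentPart R :=
  PresentedLieAlgebra.lift (nilpotentPart.e R) (lift_serre _ fun _ _ => serre_nilpotentPart_e)

theorem toNilpotentPart_e (i : Fin n) : toNilpotentPart R (e A i) = nilpotentPart.e R i :=
  PresentedLieAlgebra.lift_of ..

theorem coe_toNilpotentPart (x : SerreAlgebra A) :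
    (toNilpotentPart R x : KacMoodyAlgebra R) = toKacMoody R x :=
  LieHom.congr_fun (f := (nilpotentPart R).incl.comp (toNilpotentPart R)) (g := toKacMoody R)
    (PresentedLieAlgebra.hom_ext fun i =>
      (congrArg Subtype.val (toNilpotentPart_e i)).trans (toKacMoody_e R i).symm) x

theorem map_toKacMoody_exactBracketSpan (j : ℕ) :
    (exactBracketSpan (e A) j).map (toKacMoody R).toLinearMap =
      exactBracketSpan (KacMoodyAlgebra.e R) j := by
  rw [map_exactBracketSpan, show toKacMoody R ∘ e A = KacMoodyAlgebra.e R from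
      funext (toKacMoody_e R)]

theorem toNilpotentPart_bijective (hA : IsGeneralizedCartanMatrix A) :
    Function.Bijective (toNilpotentPart R) := by
  obtain ⟨ρ, hρ⟩ := R.exists_height
  constructor
  · intro x y hxy
    refine toKacMoody_injective R hA hρ ?_
    rw [← coe_toNilpotentPart, hxy, coe_toNilpotentPart]
  · intro ⟨y, hy⟩
    have : nilpotentPart R ≤ (toKacMoody R).range :=
      LieSubalgebra.lieSpan_le.2 (by rintro _ ⟨i, rfl⟩; exact ⟨e A i, toKacMoody_e R i⟩)
    obtain ⟨x, hx⟩ := this hy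
    exact ⟨x, Subtype.ext ((coe_toNilpotentPart x).trans hx)⟩

/-- For one direction, ad ρ has eigenvalue k on the root spaces of height k, and among elements of 𝔫
this eigenvalue singles out the brackets of length k. For the other, a nonzero bracket is a weight
vector that witnesses its weight as a root; the weight is nonzero because its value at ρ is k > 0.
-/
theorem mem_component_iff {k : ℕ} (hk : 0 < k) {x : nilpotentPart R} :
    x ∈ nilpotentPart.component R k ↔
      (x : KacMoodyAlgebra R) ∈ exactBracketSpan (KacMoodyAlgebra.e R) k := by
  obtain ⟨ρ, hρ⟩ := R.exists_height
  constructor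
  · intro hx
    obtain ⟨j, hj⟩ := exists_mem_bracketSpan x.2
    refine mem_of_mem_eigenspace_of_mem_iSup _ _ (exactBracketSpan_e_le hρ) ?_
      (bracketSpan_le_iSup j hj)
    suffices (⨆ (r : Fin n → ℕ) (_ : IsPositiveRoot R r) (_ : ∑ i, r i = k),
        rootSpace R (posWeight R r)) ≤ (heightOp R ρ).eigenspace (k : ℂ) from this hx
    refine iSup_le fun r => iSup_le fun _ => iSup_le fun hr => ?_
    rw [← hr]
    exact rootSpace_posWeight_le hρ r
  · intro hx
    suffices exactBracketSpan (KacMoodyAlgebra.e R) k ≤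
      ⨆ (r : Fin n → ℕ) (_ : IsPositiveRoot R r) (_ : ∑ i, r i = k),
        rootSpace R (posWeight R r) from this hx
    refine Submodule.span_le.2 ?_
    rintro z ⟨i, l, hl, rfl⟩
    have hz := nestedBracket_mem_rootSpace R i l
    rw [← posWeight_count] at hz
    by_cases h0 : nestedBracket (KacMoodyAlgebra.e R) i l = 0
    · rw [h0]; exact zero_mem _
    have hsum : ∑ a, (i :: l).count a = k := by rw [sum_count, List.length_cons, hl]
    refine Submodule.mem_iSup_of_mem (fun a => (i :: l).count a) (Submodule.mem_iSup_of_mem ?_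
      (Submodule.mem_iSup_of_mem hsum hz))
    refine ⟨fun h => ?_, fun h => h0 ?_⟩
    · have h1 := LinearMap.congr_fun h ρ
      simp only [posWeight, LinearMap.sum_apply, LinearMap.smul_apply, hρ, nsmul_eq_mul,
        mul_one, LinearMap.zero_apply, ← Nat.cast_sum, hsum, Nat.cast_eq_zero] at h1
      omega
    · rwa [h, Submodule.mem_bot] at hz

theorem component_eq_map {k : ℕ} (hk : 0 < k) : nilpotentPart.component R k =
    (exactBracketSpan (e A) k).map (toNilpotentPart R).toLinearMap := by
  ext x
  rw [mem_component_iff hk, ← map_toKacMoody_exactBracketSpan]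
  constructor
  · rintro ⟨u, hu, h⟩
    exact ⟨u, hu, Subtype.ext ((coe_toNilpotentPart u).trans h)⟩
  · rintro ⟨u, hu, rfl⟩
    exact ⟨u, hu, (coe_toNilpotentPart u).symm⟩

end SerreAlgebra

end Onsager

end

/-! ### Assembly of the two isomorphisms. -/

theorem theorem2p5 {n : ℕ} (A : Matrix (Fin n) (Fin n) ℤ)
    (hA : IsGeneralizedCartanMatrix A) (hsymm : IsSymmetrizableMatrix A)
    {𝔥 : Type*} [AddCommGroup 𝔥] [Module ℂ 𝔥] (R : CartanRealization A 𝔥) :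
    -- part a
    (∃ ψ : OnsagerAlgebra A ≃ₗ⁅ℂ⁆ KacMoodyAlgebra.fixedPoints R,
      (∀ i, (ψ (OnsagerAlgebra.B A i) : KacMoodyAlgebra R) =
        KacMoodyAlgebra.e R i - KacMoodyAlgebra.f R i) ∧
      ∀ ψ' : OnsagerAlgebra A →ₗ⁅ℂ⁆ KacMoodyAlgebra.fixedPoints R,
        (∀ i, (ψ' (OnsagerAlgebra.B A i) : KacMoodyAlgebra R) =
          KacMoodyAlgebra.e R i - KacMoodyAlgebra.f R i) → ψ' = ψ.toLieHom) ∧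
    -- part b
    (∃ φ : KacMoodyAlgebra.nilpotentPart R ≃ₗ⁅ℂ⁆ (OnsagerAlgebra.filtration A).Gr,
      (∀ i, φ (KacMoodyAlgebra.nilpotentPart.e R i) =
        LieFiltration.Gr.cls (OnsagerAlgebra.filtration A) 1 (OnsagerAlgebra.B A i)
          (OnsagerAlgebra.B_mem_filtration A i)) ∧
      (∀ k : ℕ+, (KacMoodyAlgebra.nilpotentPart.component R k).map φ.toLieHom.toLinearMap =
        LieFiltration.Gr.component (OnsagerAlgebra.filtration A) k) ∧
      ∀ φ' : KacMoodyAlgebra.nilpotentPart R →ₗ⁅ℂ⁆ (OnsagerAlgebra.filtration A).Gr,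
        (∀ i, φ' (KacMoodyAlgebra.nilpotentPart.e R i) =
          LieFiltration.Gr.cls (OnsagerAlgebra.filtration A) 1 (OnsagerAlgebra.B A i)
            (OnsagerAlgebra.B_mem_filtration A i)) → φ' = φ.toLieHom) := by
  refine ⟨⟨LieEquiv.ofBijective (KacMoodyAlgebra.fromOnsager R hA)
    ⟨SerreAlgebra.fromOnsager_injective hA, KacMoodyAlgebra.fromOnsager_surjective R hA⟩,
    KacMoodyAlgebra.fromOnsager_B R hA, fun ψ' hψ' => PresentedLieAlgebra.hom_ext fun i =>
      Subtype.ext ((hψ' i).trans (KacMoodyAlgebra.fromOnsager_B R hA i).symm)⟩, ?_⟩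
  -- N is isomorphic to 𝔫(A) by `α` and to Gr by `β`, and φ is `β` after the inverse of `α`.
  -- Uniqueness and the grading are both checked on N.
  let α := LieEquiv.ofBijective _ (SerreAlgebra.toNilpotentPart_bijective (R := R) hA)
  let β := LieEquiv.ofBijective (SerreAlgebra.toGr A)
    ⟨SerreAlgebra.toGr_injective R hA, SerreAlgebra.toGr_surjective⟩
  have hαβ (x : SerreAlgebra A) : (α.symm.trans β) (SerreAlgebra.toNilpotentPart R x) =
      SerreAlgebra.toGr A x :=
    congrArg (SerreAlgebra.toGr A) (α.symm_apply_apply x)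
  have hφ (i : Fin n) : (α.symm.trans β) (KacMoodyAlgebra.nilpotentPart.e R i) =
      SerreAlgebra.grB A i := by
    rw [← SerreAlgebra.toNilpotentPart_e, hαβ, SerreAlgebra.toGr_e]
  refine ⟨α.symm.trans β, hφ, fun k => ?_, fun φ' hφ' => ?_⟩
  · rw [SerreAlgebra.component_eq_map k.pos, ← SerreAlgebra.map_toGr_exactBracketSpan,
      ← Submodule.map_comp]
    congr 1
    exact LinearMap.ext hαβ
  · have h1 : φ'.comp (SerreAlgebra.toNilpotentPart R) = SerreAlgebra.toGr A :=
      PresentedLieAlgebra.hom_ext fun i => by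
        change φ' (SerreAlgebra.toNilpotentPart R (SerreAlgebra.e A i)) =
          SerreAlgebra.toGr A (SerreAlgebra.e A i)
        rw [SerreAlgebra.toNilpotentPart_e, SerreAlgebra.toGr_e]
        exact hφ' i
    ext y
    obtain ⟨x, rfl⟩ := (SerreAlgebra.toNilpotentPart_bijective (R := R) hA).2 y
    exact (LieHom.congr_fun h1 x).trans (hαβ x).symm
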